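/- Let $\mathcal H$ be a complex Hilbert space and let $(E_0,E_+,E_-)$ be a unitary representation of the algebra $\mathfrak{su}(1,1)$ on $\mathcal H$: three skew-adjoint operators which, on a dense subspace $\mathcal D$ contained in their domains and invariant under them, satisfy $[E_0,E_\pm]=\pm 2E_\pm$ and $[E_+,E_-]=E_0$. Assume that it is irreducible (no closed subspace other than $0$ and $\mathcal H$ reduces all three operators). Put $$L_0:=i(E_--E_+),\qquad L_\pm:=\tfrac12\bigl(E_0\pm i(E_++E_-)\bigr)$$ on the intersections of the domains involved, and assume that the representation is of lowest-weight type: on $\mathcal D$, the kernel of $L_-$ is one-dimensional and the kernel of $L_+$ is $\{0\}$. Let $|0\rangle_N$ be a unit vector in the kernel of $L_-$. Then there is a real number $\lambda>0$ (the lowest weight) with $L_0|0\rangle_N=\lambda|0\rangle_N$. With $N:=\frac12(L_0-\lambda)$, the operator $L_+$ is injective, and the closure of the product $L_+^{-1}N$ is an everywhere defined bounded operator $a$ on $\mathcal H$ (the $\mathfrak{su}(1,1)$-annihilation operator). For every $\xi\in\mathbb C$, the closure of $\xi L_+-\xi^*L_+^*$ generates a unique strongly continuous one-parameter group of unitary operators,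 whose value at time $1$ defines the unitary operator $U(\xi)=\exp(\xi L_+-\xi^*L_+^*)$. For every $\zeta\in\mathbb C$ with $|\zeta|<1$, the coherent state $$|\zeta\rangle_a:=U\Bigl(\tfrac12 e^{i\arg\zeta}\ln\tfrac{1+|\zeta|}{1-|\zeta|}\Bigr)|0\rangle_N$$ is an eigenvector of $a$ with eigenvalue $\zeta$, that is, $|\zeta\rangle_a\neq0$ and $$a|\zeta\rangle_a=\zeta|\zeta\rangle_a .$$ -/

import Mathlib

open scoped LinearPMap

noncomputable section

namespace SU11

variable {H : Type*} [NormedAddCommGroup H] [InnerProductSpace ℂ H]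

/-! ### Unbounded operators -/

/-- The kernel of a partially defined operator, as a subspace of the whole space. -/
def kernel (T : H →ₗ.[ℂ] H) : Submodule ℂ H :=
  (LinearMap.ker T.toFun).map T.domain.subtype

/-- The domain `{x ∈ D(T) | T x ∈ D(S)}` of the product `S T`. -/
def productDomain (S T : H →ₗ.[ℂ] H) : Submodule ℂ H :=
  (S.domain.comap T.toFun).map T.domain.subtype

theorem apply_mem_of_productDomain (S T : H →ₗ.[ℂ] H)
    (x : (T.domRestrict (productDomain S T)).domain) :
    (T.domRestrict (productDomain S T)) x ∈ S.domain := by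
  obtain ⟨y, hy, hyx⟩ := x.2.1
  have h : (T.domRestrict (productDomain S T)) x = T y := LinearPMap.domRestrict_apply hyx.symm
  rw [h]
  exact hy

/-- The product `S T`, that is `x ↦ S (T x)` on `{x ∈ D(T) | T x ∈ D(S)}`. -/
def product (S T : H →ₗ.[ℂ] H) : H →ₗ.[ℂ] H :=
  S.comp (T.domRestrict (productDomain S T)) (apply_mem_of_productDomain S T)

/-- A closed subspace `K` reduces `T` if the orthogonal projection `P` onto `K` satisfies
`P T ⊆ T P`. -/
def Reduces [CompleteSpace H] (K : ClosedSubmodule ℂ H) (T : H →ₗ.[ℂ] H) : Prop :=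
  ∀ x y : H, (x, y) ∈ T.graph →
    (K.toSubmodule.starProjection x, K.toSubmodule.starProjection y) ∈ T.graph

/-- A densely defined operator with `T* = -T`. -/
structure IsSkewAdjoint [CompleteSpace H] (T : H →ₗ.[ℂ] H) : Prop where
  dense : Dense (T.domain : Set H)
  adjoint_eq : T† = -T

/-! ### Exponentials of (essentially) skew-adjoint operators -/

variable (H) in
/-- A strongly continuous one-parameter group of unitary operators. -/
structure UnitaryGroup where
  toFun : ℝ → (H ≃ₗᵢ[ℂ] H)
  map_add : ∀ (s t : ℝ) (x : H), toFun (s + t) x = toFun s (toFun t x)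
  continuous : ∀ x : H, Continuous fun t : ℝ => toFun t x

/-- `A` is the infinitesimal generator of `V`: `x ∈ D(A)` and `A x = y` if and only if
`t ↦ V(t) x` has derivative `y` at `t = 0`. -/
def UnitaryGroup.IsGenerator (V : UnitaryGroup H) (A : H →ₗ.[ℂ] H) : Prop :=
  ∀ x y : H, (x, y) ∈ A.graph ↔ HasDerivAt (fun t : ℝ => V.toFun t x) y 0

/-- The closure of `A` generates exactly one strongly continuous one-parameter unitary group. -/
def IsExponentiable (A : H →ₗ.[ℂ] H) : Prop :=
  ∃! V : UnitaryGroup H, V.IsGenerator A.closure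

open Classical in
/-- The unitary operator `exp A`: the value at time `1` of the strongly continuous unitary group
`t ↦ exp (t A)` generated by the closure of `A` (and the identity if there is no such group). -/
def unitaryExp (A : H →ₗ.[ℂ] H) : H ≃ₗᵢ[ℂ] H :=
  if h : IsExponentiable A then h.choose.toFun 1 else LinearIsometryEquiv.refl ℂ H

/-! ### Unitary representations of the Lie algebra `su(1,1)` -/

variable (H) in
/-- A unitary representation of the algebra `su(1,1)` on `H`: skew-adjoint operators `E0`, `Ep`,
`Em` (for `E₀`, `E₊`, `E₋`) that satisfy `[E₀, E₊] = 2 E₊`, `[E₀, E₋] = -2 E₋`, `[E₊, E₋] = E₀`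
on a dense common invariant domain `dom`. The endomorphisms `e0`, `ep`, `em` of `dom` are the
restrictions of `E0`, `Ep`, `Em`. -/
structure UnitaryRep [CompleteSpace H] where
  E0 : H →ₗ.[ℂ] H
  Ep : H →ₗ.[ℂ] H
  Em : H →ₗ.[ℂ] H
  skewAdjoint_E0 : IsSkewAdjoint E0
  skewAdjoint_Ep : IsSkewAdjoint Ep
  skewAdjoint_Em : IsSkewAdjoint Em
  dom : Submodule ℂ H
  dense_dom : Dense (dom : Set H)
  e0 : Module.End ℂ dom
  ep : Module.End ℂ dom
  em : Module.End ℂ dom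
  e0_eq : ∀ x : dom, ((x : H), (e0 x : H)) ∈ E0.graph
  ep_eq : ∀ x : dom, ((x : H), (ep x : H)) ∈ Ep.graph
  em_eq : ∀ x : dom, ((x : H), (em x : H)) ∈ Em.graph
  lie_e0_ep : e0 * ep - ep * e0 = (2 : ℂ) • ep
  lie_e0_em : e0 * em - em * e0 = -((2 : ℂ) • em)
  lie_ep_em : ep * em - em * ep = e0

namespace UnitaryRep

variable [CompleteSpace H] (R : UnitaryRep H)

/-- No closed subspace other than `0` and `H` reduces all three operators. -/
def IsIrreducible : Prop :=
  ∀ K : ClosedSubmodule ℂ H, Reduces K R.E0 → Reduces K R.Ep → Reduces K R.Em → K = ⊥ ∨ K = ⊤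

/-- `L₀ = i (E₋ - E₊)`. Sums carry the intersection of the domains. -/
def L0 : H →ₗ.[ℂ] H := Complex.I • (R.Em - R.Ep)

/-- `L₊ = (E₀ + i (E₊ + E₋)) / 2`. -/
def Lp : H →ₗ.[ℂ] H := (1 / 2 : ℂ) • (R.E0 + Complex.I • (R.Ep + R.Em))

/-- `L₋ = (E₀ - i (E₊ + E₋)) / 2`. -/
def Lm : H →ₗ.[ℂ] H := (1 / 2 : ℂ) • (R.E0 - Complex.I • (R.Ep + R.Em))

/-- Lowest-weight type: on the common invariant domain, `L₋` has a one-dimensional kernel and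
`L₊` has kernel zero. -/
structure IsLowestWeightType : Prop where
  finrank_kernel_Lm : Module.finrank ℂ (kernel R.Lm ⊓ R.dom : Submodule ℂ H) = 1
  kernel_Lp : kernel R.Lp ⊓ R.dom = ⊥

/-- The number operator `N = (L₀ - l) / 2`, where `l` is the lowest weight. -/
def number (l : ℝ) : H →ₗ.[ℂ] H :=
  (1 / 2 : ℂ) • (R.L0 - ((l : ℂ) • (LinearMap.id : H →ₗ[ℂ] H)).toPMap ⊤)

/-- The annihilation operator `a = L₊⁻¹ N`, that is the closure of the product. -/
def annihilation (l : ℝ) : H →ₗ.[ℂ] H :=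
  (product R.Lp.inverse (R.number l)).closure

/-- The operator `ξ L₊ - ξ* L₊*`. -/
def displacementGenerator (ξ : ℂ) : H →ₗ.[ℂ] H :=
  ξ • R.Lp - (starRingEnd ℂ ξ) • R.Lp†

/-- `U(ξ) = exp (ξ L₊ - ξ* L₊*)`. -/
def U (ξ : ℂ) : H ≃ₗᵢ[ℂ] H := unitaryExp (R.displacementGenerator ξ)

/-- The coherent state `U (½ e^{i arg ζ} ln ((1 + |ζ|) / (1 - |ζ|))) v`, where `v` is the lowest
weight vector. -/
def coherentState (v : H) (ζ : ℂ) : H :=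
  R.U ((1 / 2 : ℂ) * Complex.exp (Complex.I * (Complex.arg ζ : ℂ)) *
    ((Real.log ((1 + ‖ζ‖) / (1 - ‖ζ‖)) : ℝ) : ℂ)) v

end UnitaryRep

end SU11

end

/-!
On the invariant domain the kernel of `L₋` is spanned by a vector `w`, and the commutation relations
give `L₀ w = l w` with `‖L₊ w‖² = l ‖w‖²`, so `l > 0` because `L₊` is injective there. Normalizing
the vectors `L₊ⁿ w` produces an orthonormal ladder `b n` with `L₊ b n = s n b (n + 1)` and
`L₋ b (n + 1) = -s n b n`, where `s n = √((n + 1) (n + l))` (`UnitaryRep.IsLadder`).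

All analytic questions reduce to one fact. On the ladder the operators `E₀`, `E₊`, `E₋` and
`ξ L₊ - ξ* L₊*` act as skew-symmetric Jacobi matrices whose entries grow linearly, and by Carleman's
criterion (`eq_zero_of_jacobi_recurrence`) such a matrix has no square-summable generalized
eigenvector for a nonzero real spectral parameter. Hence (`IsJacobi.mem_topologicalClosure`) weak
solutions of `A x = y` in the closed span of the ladder are strong solutions. Applied to `E₀`, `E₊`,
`E₋` this shows that the closed span reduces the representation, so that irreducibility makes the
ladder an orthonormal basis. Applied to `ξ L₊ - ξ* L₊*` it shows that the closure of this operator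
is skew-adjoint; it then generates a unique unitary group by Stone's theorem
(`IsSkewAdjoint.exists_isGenerator`), proved here with bounded approximations built from the
resolvents.

Since matrix elements against the basis determine everything, the operator `L₊⁻¹ N` is contained in
the bounded backward shift `b (n + 1) ↦ ((n + 1) / s n) b n` and agrees with it on the ladder, which
identifies its closure (`IsLadder.exists_annihilation_eq`).

Finally, the holomorphic family `F z = ∑ d n zⁿ b n` with `(n + 1) d (n + 1) = s n d n` consists of
eigenvectors of the backward shift with eigenvalue `z`. For `ξ = ρ e` with `|e| = 1` the curve
`cosh (ρ t) ^ (-l) • F (e tanh (ρ t))` starts at `b 0` and satisfies the differential equation of the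
unitary group, so it is the orbit of `b 0` (`IsLadder.exists_displacement_orbit`). With
`ρ = artanh ‖ζ‖` and `e = exp (i arg ζ)` its value at time `1` is a multiple of `F ζ`.
-/

open scoped InnerProductSpace Topology
open Filter

namespace SU11

section Skew

variable {H : Type*} [NormedAddCommGroup H] [InnerProductSpace ℂ H]

/-! ### Skew-symmetric graphs and skew-adjoint operators -/

/-- A subspace of `H × H` (thought of as the graph of an operator `A`) is skew-symmetric if
`⟪A x, x'⟫ + ⟪x, A x'⟫ = 0` for all `x`, `x'` in the domain. -/
def IsSkew (G : Submodule ℂ (H × H)) : Prop :=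
  ∀ p ∈ G, ∀ q ∈ G, ⟪p.2, q.1⟫_ℂ + ⟪p.1, q.2⟫_ℂ = 0

theorem IsSkew.re_inner_eq_zero {G : Submodule ℂ (H × H)} (hG : IsSkew G) {p : H × H}
    (hp : p ∈ G) : (⟪p.1, p.2⟫_ℂ).re = 0 := by
  have h := congrArg Complex.re (hG p hp p hp)
  rw [← inner_conj_symm] at h
  simp only [Complex.add_re, Complex.conj_re, Complex.zero_re] at h
  linarith

theorem IsSkew.norm_sub_smul_sq {G : Submodule ℂ (H × H)} (hG : IsSkew G) {p : H × H}
    (hp : p ∈ G) (c : ℝ) : ‖p.1 - (c : ℂ) • p.2‖ ^ 2 = ‖p.1‖ ^ 2 + c ^ 2 * ‖p.2‖ ^ 2 := by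
  rw [@norm_sub_sq ℂ, inner_smul_right, norm_smul]
  have := hG.re_inner_eq_zero hp
  simp [this, mul_pow]

/-- The closure of a skew-symmetric graph is skew-symmetric. -/
theorem IsSkew.topologicalClosure {G : Submodule ℂ (H × H)} (hG : IsSkew G) :
    IsSkew G.topologicalClosure := by
  have h1 : ∀ p ∈ G, ∀ q ∈ G.topologicalClosure, ⟪p.2, q.1⟫_ℂ + ⟪p.1, q.2⟫_ℂ = 0 := by
    intro p hp
    have hcl : IsClosed {q : H × H | ⟪p.2, q.1⟫_ℂ + ⟪p.1, q.2⟫_ℂ = 0} :=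
      isClosed_eq (by fun_prop) continuous_const
    exact fun q hq => closure_minimal (hG p hp) hcl hq
  intro p hp q hq
  have hcl : IsClosed {p : H × H | ⟪p.2, q.1⟫_ℂ + ⟪p.1, q.2⟫_ℂ = 0} :=
    isClosed_eq (by fun_prop) continuous_const
  exact closure_minimal (fun p hp => h1 p hp q hq) hcl hp

/-- If `G` is the graph of a closed skew-symmetric operator `A` whose range lies in a closed
subspace `K`, then `1 - c A` maps onto `K` as soon as no nonzero vector of `K` is orthogonal to its
range: the range is closed because `‖x - c A x‖² = ‖x‖² + c² ‖A x‖²`. -/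
theorem IsSkew.exists_sub_smul_eq [CompleteSpace H] {G : Submodule ℂ (H × H)} (hG : IsSkew G)
    (hcl : IsClosed (G : Set (H × H))) {c : ℝ} (hc : c ≠ 0) {K : Submodule ℂ H}
    (hGK : ∀ p ∈ G, p.1 - (c : ℂ) • p.2 ∈ K)
    (hK : ∀ z ∈ K, (∀ p ∈ G, ⟪p.1 - (c : ℂ) • p.2, z⟫_ℂ = 0) → z = 0)
    {u : H} (hu : u ∈ K) : ∃ p ∈ G, p.1 - (c : ℂ) • p.2 = u := by
  let Φ : (H × H) →L[ℂ] H :=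
    ContinuousLinearMap.fst ℂ H H - (c : ℂ) • ContinuousLinearMap.snd ℂ H H
  have hΦ : ∀ p, Φ p = p.1 - (c : ℂ) • p.2 := fun p => rfl
  let Ψ : G →ₗ[ℂ] H := Φ.toLinearMap.comp G.subtype
  have hΨ : ∀ p : G, Ψ p = (p : H × H).1 - (c : ℂ) • (p : H × H).2 := fun p => rfl
  let C : ℝ := max 1 |c|⁻¹
  have hC : 0 ≤ C := le_trans zero_le_one (le_max_left _ _)
  have hanti : AntilipschitzWith C.toNNReal Ψ := by
    refine AddMonoidHomClass.antilipschitz_of_bound Ψ fun p => ?_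
    have h := hG.norm_sub_smul_sq p.2 c
    rw [← hΨ] at h
    have hc' : 0 < |c| := abs_pos.2 hc
    have h1 : ‖(p : H × H).1‖ ≤ ‖Ψ p‖ := by
      refine le_of_sq_le_sq ?_ (norm_nonneg _)
      nlinarith [mul_nonneg (sq_nonneg c) (sq_nonneg ‖(p : H × H).2‖)]
    have h2 : |c| * ‖(p : H × H).2‖ ≤ ‖Ψ p‖ := by
      refine le_of_sq_le_sq ?_ (norm_nonneg _)
      rw [mul_pow, sq_abs]
      nlinarith [sq_nonneg ‖(p : H × H).1‖]
    rw [Real.coe_toNNReal _ hC]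
    change ‖(p : H × H)‖ ≤ _
    rw [Prod.norm_def]
    refine max_le (h1.trans (le_mul_of_one_le_left (norm_nonneg _) (le_max_left _ _))) ?_
    calc ‖(p : H × H).2‖ = |c|⁻¹ * (|c| * ‖(p : H × H).2‖) := by field_simp
      _ ≤ C * ‖Ψ p‖ := mul_le_mul (le_max_right _ _) h2 (by positivity) hC
  have : CompleteSpace G := hcl.completeSpace_coe
  have hrange : IsClosed (Set.range Ψ) :=
    hanti.isClosed_range (Φ.uniformContinuous.comp uniformContinuous_subtype_val)
  let M : Submodule ℂ H := LinearMap.range Ψ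
  have hM : IsClosed (M : Set H) := by
    rwa [LinearMap.coe_range]
  have : CompleteSpace M := hM.completeSpace_coe
  have hMK : M ≤ K := by
    rintro _ ⟨p, rfl⟩
    exact hGK p p.2
  have hz : u - M.starProjection u = 0 := by
    refine hK _ (K.sub_mem hu (hMK (M.starProjection_apply_mem u))) fun p hp => ?_
    have hpM : p.1 - (c : ℂ) • p.2 ∈ M := ⟨⟨p, hp⟩, rfl⟩
    exact (Submodule.mem_orthogonal M _).1 (M.sub_starProjection_mem_orthogonal u) _ hpM
  have huM : u ∈ M := by
    rw [sub_eq_zero] at hz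
    rw [hz]
    exact M.starProjection_apply_mem u
  obtain ⟨p, hp⟩ := huM
  exact ⟨p, p.2, hp⟩

variable [CompleteSpace H]

/-- The graph of a skew-adjoint operator is its own symplectic complement. -/
theorem IsSkewAdjoint.mem_graph_iff {A : H →ₗ.[ℂ] H} (hA : IsSkewAdjoint A) (x y : H) :
    (x, y) ∈ A.graph ↔ ∀ p ∈ A.graph, ⟪p.2, x⟫_ℂ + ⟪p.1, y⟫_ℂ = 0 := by
  have h1 : (x, y) ∈ A.graph ↔ (x, -y) ∈ A†.graph := by
    rw [hA.adjoint_eq]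
    simp only [LinearPMap.mem_graph_iff, LinearPMap.neg_apply, LinearPMap.neg_domain, neg_inj]
  rw [h1, LinearPMap.adjoint_graph_eq_graph_adjoint hA.dense, Submodule.mem_adjoint_iff]
  simp only [inner_neg_right, sub_neg_eq_add, Prod.forall]

theorem IsSkewAdjoint.isSkew {A : H →ₗ.[ℂ] H} (hA : IsSkewAdjoint A) : IsSkew A.graph :=
  fun p hp q hq => (hA.mem_graph_iff q.1 q.2).1 hq p hp

theorem IsSkewAdjoint.isClosed_graph {A : H →ₗ.[ℂ] H} (hA : IsSkewAdjoint A) :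
    IsClosed (A.graph : Set (H × H)) := by
  have : (A.graph : Set (H × H)) =
      ⋂ p ∈ A.graph, {q : H × H | ⟪p.2, q.1⟫_ℂ + ⟪p.1, q.2⟫_ℂ = 0} := by
    ext q
    simpa using hA.mem_graph_iff q.1 q.2
  rw [this]
  exact isClosed_biInter fun p _ => isClosed_eq (by fun_prop) continuous_const

/-- A densely defined operator whose graph is its own symplectic complement is skew-adjoint. -/
theorem isSkewAdjoint_of_mem_graph_iff {A : H →ₗ.[ℂ] H} (hd : Dense (A.domain : Set H))
    (h : ∀ x y : H, (x, y) ∈ A.graph ↔ ∀ p ∈ A.graph, ⟪p.2, x⟫_ℂ + ⟪p.1, y⟫_ℂ = 0) :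
    IsSkewAdjoint A := by
  refine ⟨hd, LinearPMap.eq_of_eq_graph ?_⟩
  ext ⟨x, y⟩
  rw [LinearPMap.adjoint_graph_eq_graph_adjoint hd, Submodule.mem_adjoint_iff]
  have h1 : (x, y) ∈ (-A).graph ↔ (x, -y) ∈ A.graph := by
    simp only [LinearPMap.mem_graph_iff, LinearPMap.neg_apply, LinearPMap.neg_domain]
    simp only [neg_eq_iff_eq_neg]
  rw [h1, h]
  simp only [inner_neg_right, ← sub_eq_add_neg, Prod.forall]

theorem IsSkewAdjoint.exists_sub_smul_eq {A : H →ₗ.[ℂ] H} (hA : IsSkewAdjoint A) {c : ℝ}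
    (hc : c ≠ 0) (u : H) : ∃ p ∈ A.graph, p.1 - (c : ℂ) • p.2 = u := by
  refine hA.isSkew.exists_sub_smul_eq hA.isClosed_graph hc (K := ⊤) (fun _ _ => trivial)
    (fun z _ hz => ?_) trivial
  have hc' : (c : ℂ) ≠ 0 := by exact_mod_cast hc
  have hmem : (z, -((c : ℂ)⁻¹ • z)) ∈ A.graph := by
    refine (hA.mem_graph_iff _ _).2 fun p hp => ?_
    have h := hz p hp
    rw [inner_sub_left, inner_smul_left, Complex.conj_ofReal, sub_eq_zero] at h
    rw [inner_neg_right, inner_smul_right, h]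
    field_simp
    ring
  have h := hA.isSkew.re_inner_eq_zero hmem
  rw [inner_neg_right, inner_smul_right, ← Complex.ofReal_inv, Complex.neg_re, Complex.re_ofReal_mul,
    neg_eq_zero, ← RCLike.re_eq_complex_re, inner_self_eq_norm_sq] at h
  simpa [hc] using h

/-- The resolvent `J = (1 - c A)⁻¹` of a skew-adjoint operator is an everywhere defined
contraction. -/
theorem IsSkewAdjoint.exists_resolvent {A : H →ₗ.[ℂ] H} (hA : IsSkewAdjoint A) {c : ℝ}
    (hc : c ≠ 0) : ∃ J : H →L[ℂ] H,
      (∀ p ∈ A.graph, J (p.1 - (c : ℂ) • p.2) = p.1) ∧ ∀ u, ‖J u‖ ≤ ‖u‖ := by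
  have hc' : (c : ℂ) ≠ 0 := by exact_mod_cast hc
  choose f hf hfu using hA.exists_sub_smul_eq hc
  have hinj : ∀ p ∈ A.graph, ∀ q ∈ A.graph,
      p.1 - (c : ℂ) • p.2 = q.1 - (c : ℂ) • q.2 → p.1 = q.1 := by
    intro p hp q hq h
    have h1 := hA.isSkew.norm_sub_smul_sq (A.graph.sub_mem hp hq) c
    have h2 : (p - q).1 - (c : ℂ) • (p - q).2 = 0 := by
      rw [Prod.fst_sub, Prod.snd_sub, smul_sub]
      rw [← sub_eq_zero] at h
      rw [← h]
      abel
    rw [h2, norm_zero] at h1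
    have h3 : ‖(p - q).1‖ ^ 2 = 0 := by
      nlinarith [mul_nonneg (sq_nonneg c) (sq_nonneg ‖(p - q).2‖), sq_nonneg ‖(p - q).1‖]
    simpa [sub_eq_zero] using h3
  let J₀ : H →ₗ[ℂ] H :=
    { toFun := fun u => (f u).1
      map_add' := fun u v => by
        refine hinj _ (hf _) _ (A.graph.add_mem (hf u) (hf v)) ?_
        rw [hfu, Prod.fst_add, Prod.snd_add, smul_add]
        nth_rewrite 1 [← hfu u, ← hfu v]
        abel
      map_smul' := fun a u => by
        refine hinj _ (hf _) _ (A.graph.smul_mem a (hf u)) ?_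
        rw [hfu, Prod.smul_fst, Prod.smul_snd, smul_comm, ← smul_sub, hfu] }
  have hbound : ∀ u, ‖J₀ u‖ ≤ 1 * ‖u‖ := by
    intro u
    have h := hA.isSkew.norm_sub_smul_sq (hf u) c
    rw [hfu] at h
    rw [one_mul]
    refine le_of_sq_le_sq ?_ (norm_nonneg _)
    change ‖(f u).1‖ ^ 2 ≤ _
    nlinarith [mul_nonneg (sq_nonneg c) (sq_nonneg ‖(f u).2‖)]
  refine ⟨J₀.mkContinuous 1 hbound, fun p hp => ?_, fun u => ?_⟩
  · exact hinj _ (hf _) _ hp (hfu _)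
  · simpa using hbound u

end Skew

section Stone

variable {H : Type*} [NormedAddCommGroup H] [InnerProductSpace ℂ H] [CompleteSpace H]

/-! ### Exponentials of bounded skew-adjoint operators -/

theorem real_smul_mem_skewAdjoint {C : H →L[ℂ] H} (hC : C ∈ skewAdjoint (H →L[ℂ] H)) (t : ℝ) :
    t • C ∈ skewAdjoint (H →L[ℂ] H) := by
  have h : star C = -C := skewAdjoint.mem_iff.1 hC
  refine skewAdjoint.mem_iff.2 ?_
  rw [← Complex.coe_smul, star_smul, h, Complex.star_def, Complex.conj_ofReal, smul_neg]

theorem exp_mem_unitary {C : H →L[ℂ] H} (hC : C ∈ skewAdjoint (H →L[ℂ] H)) :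
    NormedSpace.exp C ∈ unitary (H →L[ℂ] H) := by
  let +nondep : NormedAlgebra ℚ (H →L[ℂ] H) := NormedAlgebra.restrictScalars ℚ ℂ _
  exact NormedSpace.exp_mem_unitary_of_mem_skewAdjoint hC

theorem norm_exp_smul_apply {C : H →L[ℂ] H} (hC : C ∈ skewAdjoint (H →L[ℂ] H)) (t : ℝ) (x : H) :
    ‖NormedSpace.exp (t • C) x‖ = ‖x‖ :=
  ContinuousLinearMap.norm_map_of_mem_unitary
    (exp_mem_unitary (real_smul_mem_skewAdjoint hC t)) x

theorem hasDerivAt_exp_smul_apply (C : H →L[ℂ] H) (x : H) (t : ℝ) :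
    HasDerivAt (fun s : ℝ => NormedSpace.exp (s • C) x) (NormedSpace.exp (t • C) (C x)) t :=
  ((ContinuousLinearMap.apply ℂ H x).restrictScalars ℝ).hasFDerivAt.comp_hasDerivAt t
    (hasDerivAt_exp_smul_const (𝕂 := ℝ) C t)

theorem exp_add_smul_apply (C : H →L[ℂ] H) (s t : ℝ) (x : H) :
    NormedSpace.exp ((s + t) • C) x = NormedSpace.exp (s • C) (NormedSpace.exp (t • C) x) := by
  let +nondep : NormedAlgebra ℚ (H →L[ℂ] H) := NormedAlgebra.restrictScalars ℚ ℂ _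
  rw [add_smul, NormedSpace.exp_add_of_commute ((Commute.refl C).smul_left s |>.smul_right t)]
  rfl

theorem norm_exp_smul_apply_sub_le {C : H →L[ℂ] H} (hC : C ∈ skewAdjoint (H →L[ℂ] H)) (t : ℝ)
    (x : H) : ‖NormedSpace.exp (t • C) x - x‖ ≤ |t| * ‖C x‖ := by
  have h := convex_univ.norm_image_sub_le_of_norm_hasDerivWithin_le (x := (0 : ℝ)) (y := t)
    (fun s _ => (hasDerivAt_exp_smul_apply C x s).hasDerivWithinAt)
    (fun s _ => (norm_exp_smul_apply hC s (C x)).le) trivial trivial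
  simpa [mul_comm] using h

/-- For commuting bounded skew-adjoint operators the exponentials on a vector `x` are as close as
the operators are on `x`. -/
theorem norm_exp_smul_apply_sub_exp_smul_apply_le {B C : H →L[ℂ] H}
    (hB : B ∈ skewAdjoint (H →L[ℂ] H)) (hC : C ∈ skewAdjoint (H →L[ℂ] H)) (h : Commute B C)
    (t : ℝ) (x : H) :
    ‖NormedSpace.exp (t • B) x - NormedSpace.exp (t • C) x‖ ≤ |t| * ‖B x - C x‖ := by
  have hcomm : Commute (t • C) (t • (B - C)) :=
    ((h.symm.sub_right (Commute.refl C)).smul_left t).smul_right t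
  have h1 : t • B = t • C + t • (B - C) := by
    rw [← smul_add, add_sub_cancel]
  let +nondep : NormedAlgebra ℚ (H →L[ℂ] H) := NormedAlgebra.restrictScalars ℚ ℂ _
  rw [h1, NormedSpace.exp_add_of_commute hcomm, mul_apply_eq_comp, ← map_sub,
    norm_exp_smul_apply hC]
  exact norm_exp_smul_apply_sub_le (sub_mem hB hC) t x

/-- First-order Taylor estimate for the exponential of a bounded skew-adjoint operator `B`, where
`y` is an approximation of `B x` and `z` an approximation of `y`. -/
theorem norm_exp_smul_apply_sub_sub_le {B : H →L[ℂ] H} (hB : B ∈ skewAdjoint (H →L[ℂ] H)) (t : ℝ)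
    (x y z : H) : ‖NormedSpace.exp (t • B) x - x - t • y‖ ≤
      (‖B x - y‖ + 2 * ‖y - z‖ + |t| * ‖B z‖) * |t| := by
  have hd : ∀ s ∈ Metric.closedBall (0 : ℝ) |t|,
      HasDerivWithinAt (fun s : ℝ => NormedSpace.exp (s • B) x - s • y)
        (NormedSpace.exp (s • B) (B x) - (1 : ℝ) • y) (Metric.closedBall (0 : ℝ) |t|) s :=
    fun s _ => ((hasDerivAt_exp_smul_apply B x s).sub
      ((hasDerivAt_id s).smul_const y)).hasDerivWithinAt
  have hb : ∀ s ∈ Metric.closedBall (0 : ℝ) |t|,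
      ‖NormedSpace.exp (s • B) (B x) - (1 : ℝ) • y‖ ≤
        ‖B x - y‖ + 2 * ‖y - z‖ + |t| * ‖B z‖ := by
    intro s hs
    rw [mem_closedBall_zero_iff, Real.norm_eq_abs] at hs
    have e : NormedSpace.exp (s • B) (B x) - (1 : ℝ) • y =
        NormedSpace.exp (s • B) (B x - y) + NormedSpace.exp (s • B) (y - z)
          + (NormedSpace.exp (s • B) z - z) + (z - y) := by
      rw [map_sub, map_sub, one_smul]
      abel
    rw [e]
    refine (norm_add₄_le).trans ?_
    rw [norm_exp_smul_apply hB, norm_exp_smul_apply hB, norm_sub_rev z y]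
    have h1 := norm_exp_smul_apply_sub_le hB s z
    have h2 : |s| * ‖B z‖ ≤ |t| * ‖B z‖ := mul_le_mul_of_nonneg_right hs (norm_nonneg _)
    linarith
  have h := (convex_closedBall (0 : ℝ) |t|).norm_image_sub_le_of_norm_hasDerivWithin_le hd hb
    (x := 0) (y := t) (by simp) (by simp)
  simpa [sub_right_comm] using h

/-! ### Stone's theorem -/

/-- Strong limits of the groups generated by commuting bounded skew-adjoint operators `B n`: if
`B n x → A x` for all `x` in the dense domain of `A`, then `exp (t B n)` converges strongly to a
one-parameter unitary group whose generator extends `A`. -/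
theorem exists_unitaryGroup_of_tendsto {A : H →ₗ.[ℂ] H} (hd : Dense (A.domain : Set H))
    {B : ℕ → H →L[ℂ] H} (hB : ∀ n, B n ∈ skewAdjoint (H →L[ℂ] H))
    (hcomm : ∀ m n, Commute (B m) (B n))
    (hlim : ∀ x y, (x, y) ∈ A.graph → Tendsto (fun n => B n x) atTop (𝓝 y)) :
    ∃ V : UnitaryGroup H, ∀ x y, (x, y) ∈ A.graph → HasDerivAt (fun t => V.toFun t x) y 0 := by
  have hcauchy : ∀ (t : ℝ) (x : H), CauchySeq fun n => NormedSpace.exp (t • B n) x := by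
    intro t x
    rw [Metric.cauchySeq_iff']
    intro ε hε
    obtain ⟨x', hx', hxx'⟩ := Metric.dense_iff.1 hd x (ε / 4) (by positivity)
    obtain ⟨y, hy⟩ := LinearPMap.mem_domain_iff.1 hxx'
    have hc := (hlim x' y hy).cauchySeq
    obtain ⟨N, hN⟩ := Metric.cauchySeq_iff'.1 hc (ε / (4 * (|t| + 1))) (by positivity)
    refine ⟨N, fun n hn => ?_⟩
    have h1 := norm_exp_smul_apply_sub_exp_smul_apply_le (hB n) (hB N) (hcomm n N) t x'
    have h2 := hN n hn
    rw [dist_eq_norm] at h2 ⊢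
    have h3 : |t| * ‖B n x' - B N x'‖ ≤ ε / 4 := by
      calc |t| * ‖B n x' - B N x'‖ ≤ (|t| + 1) * (ε / (4 * (|t| + 1))) := by
            gcongr
            linarith
        _ = ε / 4 := by field_simp
    have e : NormedSpace.exp (t • B n) x - NormedSpace.exp (t • B N) x =
        NormedSpace.exp (t • B n) (x - x') +
          (NormedSpace.exp (t • B n) x' - NormedSpace.exp (t • B N) x') +
          NormedSpace.exp (t • B N) (x' - x) := by
      rw [map_sub, map_sub]
      abel
    rw [e]
    refine (norm_add₃_le).trans_lt ?_
    rw [norm_exp_smul_apply (hB n), norm_exp_smul_apply (hB N), norm_sub_rev x x']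
    rw [Metric.mem_ball, dist_eq_norm] at hx'
    linarith
  choose L hL using fun t x => cauchySeq_tendsto_of_complete (hcauchy t x)
  have hLadd : ∀ t x y, L t (x + y) = L t x + L t y := fun t x y =>
    tendsto_nhds_unique (hL t (x + y)) (by simpa using (hL t x).add (hL t y))
  have hLsmul : ∀ t (c : ℂ) x, L t (c • x) = c • L t x := fun t c x =>
    tendsto_nhds_unique (hL t (c • x)) (by simpa using (hL t x).const_smul c)
  have hLnorm : ∀ t x, ‖L t x‖ = ‖x‖ := fun t x =>
    tendsto_nhds_unique (hL t x).norm (by simp [norm_exp_smul_apply (hB _)])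
  have hLsub : ∀ t x y, L t (x - y) = L t x - L t y := fun t x y =>
    tendsto_nhds_unique (hL t (x - y)) (by simpa using (hL t x).sub (hL t y))
  have hLgroup : ∀ s t x, L (s + t) x = L s (L t x) := by
    intro s t x
    refine tendsto_nhds_unique (hL (s + t) x) ?_
    have h1 : Tendsto (fun n => NormedSpace.exp (s • B n) (NormedSpace.exp (t • B n) x - L t x))
        atTop (𝓝 0) := by
      rw [tendsto_zero_iff_norm_tendsto_zero]
      simp only [norm_exp_smul_apply (hB _)]
      exact tendsto_iff_norm_sub_tendsto_zero.1 (hL t x)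
    simpa [exp_add_smul_apply] using h1.add (hL s (L t x))
  have hLzero : ∀ x, L 0 x = x := fun x =>
    tendsto_nhds_unique (hL 0 x) (by simp)
  have hLcont0 : ∀ x, ContinuousAt (fun t => L t x) 0 := by
    intro x
    rw [Metric.continuousAt_iff]
    intro ε hε
    obtain ⟨x', hx', hxx'⟩ := Metric.dense_iff.1 hd x (ε / 4) (by positivity)
    obtain ⟨y, hy⟩ := LinearPMap.mem_domain_iff.1 hxx'
    refine ⟨ε / (4 * (‖y‖ + 1)), by positivity, fun t ht => ?_⟩
    have h1 : ‖L t x' - x'‖ ≤ |t| * ‖y‖ :=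
      le_of_tendsto_of_tendsto ((hL t x').sub_const x').norm
        ((hlim x' y hy).norm.const_mul |t|)
        (Eventually.of_forall fun n => norm_exp_smul_apply_sub_le (hB n) t x')
    rw [dist_zero_right, Real.norm_eq_abs] at ht
    have h3 : |t| * ‖y‖ ≤ ε / 4 := by
      calc |t| * ‖y‖ ≤ (ε / (4 * (‖y‖ + 1))) * (‖y‖ + 1) := by
            gcongr
            linarith
        _ = ε / 4 := by field_simp
    have e : L t x - x = L t (x - x') + (L t x' - x') + (x' - x) := by
      rw [hLsub]
      abel
    rw [dist_eq_norm, hLzero, e]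
    refine (norm_add₃_le).trans_lt ?_
    rw [hLnorm, norm_sub_rev x x']
    rw [Metric.mem_ball, dist_eq_norm] at hx'
    linarith
  let Lli : ℝ → (H ≃ₗᵢ[ℂ] H) := fun t =>
    { toFun := L t
      invFun := L (-t)
      map_add' := hLadd t
      map_smul' := hLsmul t
      left_inv := fun x => by rw [← hLgroup, neg_add_cancel, hLzero]
      right_inv := fun x => by rw [← hLgroup, add_neg_cancel, hLzero]
      norm_map' := hLnorm t }
  refine ⟨⟨Lli, hLgroup, fun x => ?_⟩, fun x y hxy => ?_⟩
  · rw [continuous_iff_continuousAt]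
    intro t
    have h1 : (fun s => Lli s x) = (fun s => L t (L s x)) ∘ fun s => s - t := by
      funext s
      change L s x = L t (L (s - t) x)
      rw [← hLgroup, add_sub_cancel]
    rw [h1]
    refine ContinuousAt.comp ?_ (by fun_prop)
    rw [sub_self]
    exact (Lli t).continuous.continuousAt.comp (hLcont0 x)
  · change HasDerivAt (fun t => L t x) y 0
    rw [hasDerivAt_iff_isLittleO_nhds_zero, Asymptotics.isLittleO_iff]
    intro ε hε
    obtain ⟨y', hy', hyy'⟩ := Metric.dense_iff.1 hd y (ε / 4) (by positivity)
    obtain ⟨z, hz⟩ := LinearPMap.mem_domain_iff.1 hyy'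
    have hδ : 0 < ε / (2 * (‖z‖ + 1)) := by positivity
    filter_upwards [Metric.ball_mem_nhds (0 : ℝ) hδ] with t ht
    have h1 : ‖L t x - x - t • y‖ ≤ (0 + 2 * ‖y - y'‖ + |t| * ‖z‖) * |t| := by
      have h0 : Tendsto (fun n => ‖B n x - y‖) atTop (𝓝 0) :=
        tendsto_iff_norm_sub_tendsto_zero.1 (hlim x y hxy)
      exact le_of_tendsto_of_tendsto (((hL t x).sub_const x).sub_const (t • y)).norm
        (((h0.add_const (2 * ‖y - y'‖)).add ((hlim y' z hz).norm.const_mul |t|)).mul_const |t|)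
        (Eventually.of_forall fun n => norm_exp_smul_apply_sub_sub_le (hB n) t x y y')
    rw [Metric.mem_ball, dist_zero_right, Real.norm_eq_abs] at ht
    have h3 : |t| * ‖z‖ ≤ ε / 2 := by
      calc |t| * ‖z‖ ≤ (ε / (2 * (‖z‖ + 1))) * (‖z‖ + 1) := by
            gcongr
            linarith
        _ = ε / 2 := by field_simp
    rw [Metric.mem_ball, dist_eq_norm, norm_sub_rev] at hy'
    rw [zero_add, hLzero, Real.norm_eq_abs]
    refine h1.trans (mul_le_mul_of_nonneg_right ?_ (abs_nonneg t))
    linarith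

end Stone

section Generator

variable {H : Type*} [NormedAddCommGroup H] [InnerProductSpace ℂ H]

theorem UnitaryGroup.map_zero (V : UnitaryGroup H) (x : H) : V.toFun 0 x = x := by
  have h := V.map_add 0 0 x
  rw [add_zero] at h
  exact ((V.toFun 0).injective h).symm

/-- Orbits of a unitary group stay in the graph of the generator and are differentiable at all
times. -/
theorem UnitaryGroup.IsGenerator.orbit {V : UnitaryGroup H} {A : H →ₗ.[ℂ] H} (hV : V.IsGenerator A)
    {x y : H} (hxy : (x, y) ∈ A.graph) (t : ℝ) :
    (V.toFun t x, V.toFun t y) ∈ A.graph ∧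
      HasDerivAt (fun s : ℝ => V.toFun s x) (V.toFun t y) t := by
  have h0 : HasDerivAt (fun s : ℝ => V.toFun t (V.toFun s x)) (V.toFun t y) 0 :=
    (((V.toFun t).toContinuousLinearEquiv : H →L[ℂ] H).restrictScalars
      ℝ).hasFDerivAt.comp_hasDerivAt (0 : ℝ) ((hV x y).1 hxy)
  refine ⟨(hV _ _).2 ?_, ?_⟩
  · refine h0.congr_of_eventuallyEq (Eventually.of_forall fun s => ?_)
    change V.toFun s (V.toFun t x) = V.toFun t (V.toFun s x)
    rw [← V.map_add, ← V.map_add, add_comm]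
  · have h1 : HasDerivAt (fun s : ℝ => V.toFun t (V.toFun (s - t) x)) (V.toFun t y) t := by
      have h2 := HasDerivAt.comp_sub_const (f := fun s : ℝ => V.toFun t (V.toFun s x)) t t
        (f' := V.toFun t y) (by rwa [sub_self])
      exact h2
    refine h1.congr_of_eventuallyEq (Eventually.of_forall fun s => ?_)
    change V.toFun s x = V.toFun t (V.toFun (s - t) x)
    rw [← V.map_add, add_sub_cancel]

/-- Solutions of `φ' = A φ` for a skew-symmetric operator `A` are determined by their initial
value, since `‖φ - ψ‖²` has derivative `2 Re ⟪φ - ψ, A (φ - ψ)⟫ = 0`. -/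
theorem IsSkew.eq_of_hasDerivAt {G : Submodule ℂ (H × H)} (hG : IsSkew G) {φ φ' ψ ψ' : ℝ → H}
    (hφ : ∀ t, HasDerivAt φ (φ' t) t) (hφG : ∀ t, (φ t, φ' t) ∈ G)
    (hψ : ∀ t, HasDerivAt ψ (ψ' t) t) (hψG : ∀ t, (ψ t, ψ' t) ∈ G)
    (h0 : φ 0 = ψ 0) (t : ℝ) : φ t = ψ t := by
  let e : ℝ → ℂ := fun t => ⟪φ t - ψ t, φ t - ψ t⟫_ℂ
  have he : ∀ t, HasDerivAt e 0 t := by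
    intro t
    have h := ((hφ t).sub (hψ t)).inner ℂ ((hφ t).sub (hψ t))
    have hmem := G.sub_mem (hφG t) (hψG t)
    have h2 := hG _ hmem _ hmem
    rw [add_comm] at h2
    rw [← h2]
    exact h
  have hconst : e t = e 0 :=
    is_const_of_deriv_eq_zero (fun t => (he t).differentiableAt) (fun t => (he t).deriv) t 0
  have h1 : ⟪φ t - ψ t, φ t - ψ t⟫_ℂ = 0 := by
    have h2 : e 0 = 0 := by simp [e, h0]
    exact hconst.trans h2
  exact sub_eq_zero.1 (inner_self_eq_zero.1 h1)

/-- A densely defined skew-symmetric operator generates at most one unitary group. -/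
theorem UnitaryGroup.eq_of_isGenerator {A : H →ₗ.[ℂ] H} (hd : Dense (A.domain : Set H))
    (hA : IsSkew A.graph) {V W : UnitaryGroup H} (hV : V.IsGenerator A) (hW : W.IsGenerator A) :
    V = W := by
  have h : V.toFun = W.toFun := by
    funext t
    refine LinearIsometryEquiv.ext fun x => ?_
    refine congrFun (Continuous.ext_on hd (V.toFun t).continuous (W.toFun t).continuous ?_) x
    intro x hx
    obtain ⟨y, hy⟩ := LinearPMap.mem_domain_iff.1 hx
    exact hA.eq_of_hasDerivAt (fun t => (hV.orbit hy t).2) (fun t => (hV.orbit hy t).1)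
      (fun t => (hW.orbit hy t).2) (fun t => (hW.orbit hy t).1)
      (by rw [V.map_zero, W.map_zero]) t
  cases V
  cases W
  cases h
  rfl

theorem exists_isGenerator_and_unitaryExp_eq {A : H →ₗ.[ℂ] H} (hA : IsExponentiable A) :
    ∃ V : UnitaryGroup H, V.IsGenerator A.closure ∧ unitaryExp A = V.toFun 1 :=
  ⟨hA.choose, hA.choose_spec.1, by rw [unitaryExp, dif_pos hA]⟩

variable [CompleteSpace H]

/-- A unitary group whose generator extends a skew-adjoint operator `A` is generated by `A`:
skew-adjoint operators have no proper skew-symmetric extensions. -/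
theorem IsSkewAdjoint.isGenerator_of_hasDerivAt {A : H →ₗ.[ℂ] H} (hA : IsSkewAdjoint A)
    {V : UnitaryGroup H}
    (hV : ∀ x y, (x, y) ∈ A.graph → HasDerivAt (fun t => V.toFun t x) y 0) : V.IsGenerator A := by
  refine fun x y => ⟨hV x y, fun hxy => (hA.mem_graph_iff x y).2 fun p hp => ?_⟩
  have h1 := (hV p.1 p.2 hp).inner ℂ hxy
  have h2 : (fun t : ℝ => ⟪V.toFun t p.1, V.toFun t x⟫_ℂ) = fun _ => ⟪p.1, x⟫_ℂ := by
    funext t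
    exact (V.toFun t).inner_map_map _ _
  rw [h2] at h1
  have h3 := h1.unique (hasDerivAt_const (0 : ℝ) _)
  rw [V.map_zero, V.map_zero, add_comm] at h3
  exact h3

/-- Stone's theorem: a skew-adjoint operator `A` generates a strongly continuous unitary group.
The bounded approximations are `(J ε - J (-ε)) / (2 ε)` with the resolvents `J c = (1 - c A)⁻¹`. -/
theorem IsSkewAdjoint.exists_isGenerator {A : H →ₗ.[ℂ] H} (hA : IsSkewAdjoint A) :
    ∃ V : UnitaryGroup H, V.IsGenerator A := by
  choose J hJsub hJnorm using fun c : {c : ℝ // c ≠ 0} => hA.exists_resolvent c.2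
  have hJadj : ∀ c d : {c : ℝ // c ≠ 0}, (d : ℝ) = -c → ∀ u v, ⟪J c u, v⟫_ℂ = ⟪u, J d v⟫_ℂ := by
    intro c d hcd u v
    obtain ⟨p, hp, rfl⟩ := hA.exists_sub_smul_eq c.2 u
    obtain ⟨q, hq, rfl⟩ := hA.exists_sub_smul_eq d.2 v
    rw [hJsub c p hp, hJsub d q hq, inner_sub_left, inner_sub_right, inner_smul_left,
      inner_smul_right, hcd, Complex.conj_ofReal, Complex.ofReal_neg]
    linear_combination (c : ℂ) * hA.isSkew p hp q hq
  -- Resolvents commute because `A` commutes with its resolvents: with `w = (1 - d A)⁻¹ u` and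
  -- `v = (1 - c A)⁻¹ w`, the vector `(1 - d A) v` is `(1 - c A)⁻¹ u`.
  have hJcomm : ∀ c d, Commute (J c) (J d) := by
    intro c d
    ext u
    have hc : ((c : ℝ) : ℂ) ≠ 0 := by exact_mod_cast c.2
    obtain ⟨⟨w, w'⟩, hw, rfl⟩ := hA.exists_sub_smul_eq d.2 u
    obtain ⟨⟨v, v'⟩, hv, hvw⟩ := hA.exists_sub_smul_eq c.2 w
    simp only at hvw ⊢
    have hv2 : (v', ((c : ℝ) : ℂ)⁻¹ • (v' - w')) ∈ A.graph := by
      have h := A.graph.smul_mem ((c : ℝ) : ℂ)⁻¹ (A.graph.sub_mem hv hw)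
      have e : ((c : ℝ) : ℂ)⁻¹ • (v - w) = v' := by
        rw [← hvw, sub_sub_cancel, inv_smul_smul₀ hc]
      rw [Prod.mk_sub_mk, Prod.smul_mk, e] at h
      exact h
    have h3 := A.graph.sub_mem hv (A.graph.smul_mem ((d : ℝ) : ℂ) hv2)
    have h4 := hJsub c _ h3
    have e1 : v - ((d : ℝ) : ℂ) • v' - ((c : ℝ) : ℂ) • (v' - ((d : ℝ) : ℂ) •
        ((c : ℝ) : ℂ)⁻¹ • (v' - w')) = w - ((d : ℝ) : ℂ) • w' := by
      rw [smul_sub ((c : ℝ) : ℂ), smul_comm ((c : ℝ) : ℂ) ((d : ℝ) : ℂ), smul_inv_smul₀ hc, ← hvw,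
        smul_sub]
      abel
    simp only [Prod.mk_sub_mk, Prod.smul_mk, e1] at h4
    have h5 := hJsub d _ hw
    have h6 := hJsub c _ hv
    have h7 := hJsub d _ hv
    simp only [hvw] at h5 h6 h7
    change J c (J d _) = J d (J c _)
    rw [h4, h5, h6, h7]
  have hJtendsto : ∀ c : ℕ → {c : ℝ // c ≠ 0}, Tendsto (fun n => (c n : ℝ)) atTop (𝓝 0) →
      ∀ y, Tendsto (fun n => J (c n) y) atTop (𝓝 y) := by
    intro c hc y
    rw [Metric.tendsto_atTop]
    intro δ hδ
    obtain ⟨x, hx, hxA⟩ := Metric.dense_iff.1 hA.dense y (δ / 4) (by positivity)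
    obtain ⟨z, hz⟩ := LinearPMap.mem_domain_iff.1 hxA
    obtain ⟨N, hN⟩ := Metric.tendsto_atTop.1 hc (δ / (4 * (‖z‖ + 1))) (by positivity)
    refine ⟨N, fun n hn => ?_⟩
    have h1 := hN n hn
    rw [dist_zero_right, Real.norm_eq_abs] at h1
    have h2 : J (c n) x - x = ((c n : ℝ) : ℂ) • J (c n) z := by
      have h := hJsub (c n) _ hz
      simp only [map_sub, map_smul] at h
      nth_rewrite 2 [← h]
      rw [sub_sub_cancel]
    have h3 : ‖J (c n) x - x‖ ≤ δ / 4 := by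
      calc ‖J (c n) x - x‖ = |(c n : ℝ)| * ‖J (c n) z‖ := by
            rw [h2, norm_smul, Complex.norm_real, Real.norm_eq_abs]
        _ ≤ (δ / (4 * (‖z‖ + 1))) * (‖z‖ + 1) := by
            gcongr
            exact (hJnorm (c n) z).trans (by linarith)
        _ = δ / 4 := by field_simp
    have e : J (c n) y - y = J (c n) (y - x) + (J (c n) x - x) + (x - y) := by
      rw [map_sub]
      abel
    rw [dist_eq_norm, e]
    refine (norm_add₃_le).trans_lt ?_
    have h4 := hJnorm (c n) (y - x)
    rw [Metric.mem_ball, dist_eq_norm] at hx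
    rw [norm_sub_rev y x] at h4
    linarith
  have hεpos : ∀ n : ℕ, (1 / ((n : ℝ) + 1)) ≠ 0 := fun n => by positivity
  let ε : ℕ → {c : ℝ // c ≠ 0} := fun n => ⟨1 / ((n : ℝ) + 1), hεpos n⟩
  let ε' : ℕ → {c : ℝ // c ≠ 0} := fun n => ⟨-(1 / ((n : ℝ) + 1)), neg_ne_zero.2 (hεpos n)⟩
  have hε : Tendsto (fun n => (ε n : ℝ)) atTop (𝓝 0) := tendsto_one_div_add_atTop_nhds_zero_nat
  have hε' : Tendsto (fun n => (ε' n : ℝ)) atTop (𝓝 0) := by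
    have h := hε.neg
    rwa [neg_zero] at h
  have hεε : ∀ n, (ε' n : ℝ) = -(ε n : ℝ) := fun n => rfl
  let B : ℕ → H →L[ℂ] H := fun n => (2 * ((ε n : ℝ) : ℂ))⁻¹ • (J (ε n) - J (ε' n))
  have hBskew : ∀ n, B n ∈ skewAdjoint (H →L[ℂ] H) := by
    intro n
    refine skewAdjoint.mem_iff.2 ?_
    rw [ContinuousLinearMap.star_eq_adjoint]
    refine ((ContinuousLinearMap.eq_adjoint_iff _ _).2 fun u v => ?_).symm
    simp only [B, neg_apply, smul_apply,
      sub_apply, inner_neg_left, inner_smul_left, inner_smul_right,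
      inner_sub_left, inner_sub_right]
    rw [hJadj (ε n) (ε' n) (hεε n), hJadj (ε' n) (ε n) (by rw [hεε, neg_neg])]
    simp only [map_inv₀, map_mul, Complex.conj_ofReal, map_ofNat]
    ring
  have hBcomm : ∀ m n, Commute (B m) (B n) := fun m n =>
    (((((hJcomm _ _).sub_right (hJcomm _ _)).sub_left
      ((hJcomm _ _).sub_right (hJcomm _ _))).smul_left _).smul_right _)
  -- On the domain of `A` the approximation is `(J ε A x + J (-ε) A x) / 2`.
  have hBlim : ∀ x y, (x, y) ∈ A.graph → Tendsto (fun n => B n x) atTop (𝓝 y) := by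
    intro x y hxy
    have h : ∀ n, B n x = (2 : ℂ)⁻¹ • (J (ε n) y + J (ε' n) y) := by
      intro n
      have hc : ((ε n : ℝ) : ℂ) ≠ 0 := by exact_mod_cast (ε n).2
      have h1 := hJsub (ε n) _ hxy
      have h2 := hJsub (ε' n) _ hxy
      simp only [map_sub, map_smul, sub_eq_iff_eq_add, hεε, Complex.ofReal_neg, neg_smul, map_neg] at h1 h2
      change (2 * ((ε n : ℝ) : ℂ))⁻¹ • (J (ε n) x - J (ε' n) x) = _
      rw [h1, h2, mul_inv, mul_smul]
      congr 1
      rw [inv_smul_eq_iff₀ hc, smul_add]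
      abel
    simp only [h]
    have h3 := ((hJtendsto ε hε y).add (hJtendsto ε' hε' y)).const_smul (2 : ℂ)⁻¹
    have e : (2 : ℂ)⁻¹ • (y + y) = y := by
      rw [← two_smul ℂ y, inv_smul_smul₀ two_ne_zero]
    rwa [e] at h3
  obtain ⟨V, hV⟩ := exists_unitaryGroup_of_tendsto hA.dense hBskew hBcomm hBlim
  exact ⟨V, hA.isGenerator_of_hasDerivAt hV⟩

theorem isExponentiable_of_isSkewAdjoint_closure {A : H →ₗ.[ℂ] H}
    (hA : IsSkewAdjoint A.closure) : IsExponentiable A := by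
  obtain ⟨V, hV⟩ := hA.exists_isGenerator
  exact ⟨V, hV, fun W hW => UnitaryGroup.eq_of_isGenerator hA.dense hA.isSkew hW hV⟩

end Generator

/-! ### Jacobi operators and Carleman's criterion -/

/-- Carleman's criterion: a square-summable solution `z` of the three-term recurrence of a
skew-symmetric Jacobi matrix with spectral parameter `c ∈ ℝ \ {0}` vanishes if the off-diagonal
entries `s n` grow at most linearly. Telescoping gives
`Re (ᾱ s n z (n + 1) z̄ n) = c ∑_{k ≤ n} ‖z k‖²`, so a nonzero `z` would bound the harmonic series
by `∑ ‖z n‖ ‖z (n + 1)‖`. -/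
theorem eq_zero_of_jacobi_recurrence {α : ℂ} {β s : ℕ → ℝ} {C c : ℝ} (hs0 : ∀ n, 0 ≤ s n)
    (hs : ∀ n, s n ≤ C * (n + 1)) {z : ℕ → ℂ} (hz : Summable fun n => ‖z n‖ ^ 2) (hc : c ≠ 0)
    (h0 : starRingEnd ℂ α * s 0 * z 1 - Complex.I * β 0 * z 0 = c * z 0)
    (hn : ∀ n, starRingEnd ℂ α * s (n + 1) * z (n + 2) - Complex.I * β (n + 1) * z (n + 1) -
      α * s n * z n = c * z (n + 1)) (m : ℕ) : z m = 0 := by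
  have hq : ∀ n, (starRingEnd ℂ α * s n * z (n + 1) * starRingEnd ℂ (z n)).re =
      c * ∑ k ∈ Finset.range (n + 1), ‖z k‖ ^ 2 := by
    intro n
    induction n with
    | zero =>
      have h := congrArg (fun w => (w * starRingEnd ℂ (z 0)).re) h0
      simp only [Finset.range_one, Finset.sum_singleton, zero_add, Complex.sq_norm,
        Complex.normSq_apply]
      simp at h ⊢
      linarith
    | succ n ih =>
      have h := congrArg (fun w => (w * starRingEnd ℂ (z (n + 1))).re) (hn n)
      rw [Finset.sum_range_succ, mul_add, ← ih, Complex.sq_norm, Complex.normSq_apply]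
      simp at h ⊢
      linarith
  by_contra hm
  have hδ : 0 < |c| * ‖z m‖ ^ 2 := by positivity
  set δ := |c| * ‖z m‖ ^ 2 with hδdef
  have hg : Summable fun n => ‖z n‖ ^ 2 + ‖z (n + 1)‖ ^ 2 :=
    hz.add ((summable_nat_add_iff 1).2 hz)
  have key : ∀ n, m ≤ n → 1 / ((n : ℝ) + 1) ≤
      (‖α‖ * C / δ) * (‖z n‖ ^ 2 + ‖z (n + 1)‖ ^ 2) := by
    intro n hmn
    have h1 : δ ≤ |c * ∑ k ∈ Finset.range (n + 1), ‖z k‖ ^ 2| := by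
      rw [abs_mul, hδdef]
      refine mul_le_mul_of_nonneg_left ?_ (abs_nonneg c)
      refine le_trans ?_ (le_abs_self _)
      exact Finset.single_le_sum (f := fun k => ‖z k‖ ^ 2) (fun k _ => by positivity)
        (Finset.mem_range.2 (Nat.lt_succ_of_le hmn))
    rw [← hq n] at h1
    have h2 := h1.trans (Complex.abs_re_le_norm _)
    rw [norm_mul, norm_mul, norm_mul, RCLike.norm_conj, RCLike.norm_conj, Complex.norm_real,
      Real.norm_of_nonneg (hs0 n)] at h2
    have h3 : ‖z (n + 1)‖ * ‖z n‖ ≤ ‖z n‖ ^ 2 + ‖z (n + 1)‖ ^ 2 := by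
      nlinarith [sq_nonneg (‖z (n + 1)‖ - ‖z n‖), sq_nonneg ‖z n‖, sq_nonneg ‖z (n + 1)‖]
    have h4 : δ ≤ ‖α‖ * (C * (n + 1)) * (‖z n‖ ^ 2 + ‖z (n + 1)‖ ^ 2) := by
      calc δ ≤ ‖α‖ * s n * (‖z (n + 1)‖ * ‖z n‖) := by linarith
        _ ≤ ‖α‖ * (C * (n + 1)) * (‖z n‖ ^ 2 + ‖z (n + 1)‖ ^ 2) := by
            have hsn := hs0 n
            have hsC := hs n
            have hC : 0 ≤ C * (n + 1) := hsn.trans hsC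
            gcongr
    rw [div_le_iff₀ (by positivity)]
    have e : ‖α‖ * C / δ * (‖z n‖ ^ 2 + ‖z (n + 1)‖ ^ 2) * ((n : ℝ) + 1) =
        (‖α‖ * (C * (n + 1)) * (‖z n‖ ^ 2 + ‖z (n + 1)‖ ^ 2)) / δ := by ring
    rw [e, le_div_iff₀ hδ, one_mul]
    exact h4
  have hsum : Summable fun n : ℕ => 1 / (((n + m : ℕ) : ℝ) + 1) :=
    Summable.of_nonneg_of_le (fun n => by positivity) (fun n => key (n + m) (by omega))
      ((summable_nat_add_iff m).2 (hg.mul_left (‖α‖ * C / δ)))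
  have hsum2 : Summable fun n : ℕ => 1 / ((n : ℝ) + 1) :=
    (summable_nat_add_iff (f := fun n : ℕ => 1 / ((n : ℝ) + 1)) m).1 hsum
  have hsum3 : Summable fun n : ℕ => 1 / (n : ℝ) := by
    refine (summable_nat_add_iff (f := fun n : ℕ => 1 / (n : ℝ)) 1).1 ?_
    simpa using hsum2
  exact Real.not_summable_one_div_natCast hsum3

section Jacobi

variable {H : Type*} [NormedAddCommGroup H] [InnerProductSpace ℂ H]

/-- `T n` is the image of `b n` under the skew-symmetric Jacobi matrix with diagonal `i β` and
off-diagonal entries `α s` and `-ᾱ s`. -/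
structure IsJacobi (b T : ℕ → H) (α : ℂ) (β s : ℕ → ℝ) : Prop where
  zero : T 0 = (α * s 0) • b 1 + (Complex.I * β 0) • b 0
  succ : ∀ n, T (n + 1) = (α * s (n + 1)) • b (n + 2) + (Complex.I * β (n + 1)) • b (n + 1) -
    (starRingEnd ℂ α * s n) • b n

variable {b T : ℕ → H} {α : ℂ} {β s : ℕ → ℝ} {C : ℝ}

theorem IsJacobi.inner_zero (hT : IsJacobi b T α β s) (z : H) :
    ⟪T 0, z⟫_ℂ = starRingEnd ℂ α * s 0 * ⟪b 1, z⟫_ℂ - Complex.I * β 0 * ⟪b 0, z⟫_ℂ := by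
  simp only [hT.zero, inner_add_left, inner_smul_left, map_mul, Complex.conj_ofReal,
    Complex.conj_I]
  ring

theorem IsJacobi.inner_succ (hT : IsJacobi b T α β s) (n : ℕ) (z : H) :
    ⟪T (n + 1), z⟫_ℂ = starRingEnd ℂ α * s (n + 1) * ⟪b (n + 2), z⟫_ℂ -
      Complex.I * β (n + 1) * ⟪b (n + 1), z⟫_ℂ - α * s n * ⟪b n, z⟫_ℂ := by
  simp only [hT.succ, inner_add_left, inner_sub_left, inner_smul_left, map_mul,
    Complex.conj_ofReal, Complex.conj_I, Complex.conj_conj]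
  ring

theorem IsJacobi.inner_eq_zero (hT : IsJacobi b T α β s) (hb : Orthonormal ℂ b)
    (hs0 : ∀ n, 0 ≤ s n) (hs : ∀ n, s n ≤ C * (n + 1)) {c : ℝ} (hc : c ≠ 0) {z : H}
    (hz : ∀ n, ⟪T n, z⟫_ℂ = c * ⟪b n, z⟫_ℂ) (n : ℕ) : ⟪b n, z⟫_ℂ = 0 :=
  eq_zero_of_jacobi_recurrence (z := fun n => ⟪b n, z⟫_ℂ) hs0 hs (hb.inner_products_summable z) hc
    (by rw [← hT.inner_zero, hz]) (fun n => by rw [← hT.inner_succ, hz]) n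

theorem eq_zero_of_mem_closure_span {b : ℕ → H} {z : H}
    (hz : z ∈ (Submodule.span ℂ (Set.range b)).topologicalClosure)
    (h : ∀ n, ⟪b n, z⟫_ℂ = 0) : z = 0 := by
  have hle : (Submodule.span ℂ (Set.range b)).topologicalClosure ≤ (ℂ ∙ z)ᗮ := by
    refine Submodule.topologicalClosure_minimal _ (Submodule.span_le.2 ?_)
      (Submodule.isClosed_orthogonal _)
    rintro _ ⟨n, rfl⟩
    exact Submodule.mem_orthogonal_singleton_iff_inner_left.2 (h n)
  exact inner_self_eq_zero.1 (Submodule.mem_orthogonal_singleton_iff_inner_left.1 (hle hz))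

/-- Essential skew-adjointness of Jacobi operators: if `A` is a skew-symmetric operator that acts
on an orthonormal sequence `b` as a Jacobi matrix with entries of at most linear growth, then every
pair `x`, `y` in the closed span of `b` which satisfies `A x = y` weakly on `b` is in the closure
of the graph of `A`. -/
theorem IsJacobi.mem_topologicalClosure [CompleteSpace H] (hT : IsJacobi b T α β s)
    (hb : Orthonormal ℂ b) (hs0 : ∀ n, 0 ≤ s n) (hs : ∀ n, s n ≤ C * (n + 1))
    {G : Submodule ℂ (H × H)} (hG : IsSkew G) (hTG : ∀ n, (b n, T n) ∈ G) {x y : H}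
    (hx : x ∈ (Submodule.span ℂ (Set.range b)).topologicalClosure)
    (hy : y ∈ (Submodule.span ℂ (Set.range b)).topologicalClosure)
    (hxy : ∀ n, ⟪T n, x⟫_ℂ + ⟪b n, y⟫_ℂ = 0) : (x, y) ∈ G.topologicalClosure := by
  set K := (Submodule.span ℂ (Set.range b)).topologicalClosure with hK
  let G₀ : Submodule ℂ (H × H) := Submodule.span ℂ (Set.range fun n => (b n, T n))
  have hG₀ : G₀ ≤ G := by
    refine Submodule.span_le.2 ?_
    rintro _ ⟨n, rfl⟩
    exact hTG n
  have hle : G₀.topologicalClosure ≤ G.topologicalClosure := Submodule.topologicalClosure_mono hG₀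
  have hskew : IsSkew G₀.topologicalClosure := fun p hp q hq =>
    hG.topologicalClosure p (hle hp) q (hle hq)
  have hgen : ∀ n, (b n, T n) ∈ G₀.topologicalClosure := fun n =>
    G₀.le_topologicalClosure (Submodule.subset_span ⟨n, rfl⟩)
  have hbK : ∀ n, b n ∈ K := fun n =>
    Submodule.le_topologicalClosure _ (Submodule.subset_span ⟨n, rfl⟩)
  have hTK : ∀ n, T n ∈ K := by
    intro n
    cases n with
    | zero =>
      rw [hT.zero]
      exact K.add_mem (K.smul_mem _ (hbK _)) (K.smul_mem _ (hbK _))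
    | succ n =>
      rw [hT.succ]
      exact K.sub_mem (K.add_mem (K.smul_mem _ (hbK _)) (K.smul_mem _ (hbK _)))
        (K.smul_mem _ (hbK _))
  have hGK : G₀.topologicalClosure ≤ K.prod K := by
    refine Submodule.topologicalClosure_minimal _ (Submodule.span_le.2 ?_) ?_
    · rintro _ ⟨n, rfl⟩
      exact ⟨hbK n, hTK n⟩
    · change IsClosed ((K : Set H) ×ˢ (K : Set H))
      exact (Submodule.isClosed_topologicalClosure _).prod (Submodule.isClosed_topologicalClosure _)
  -- Solve `(1 + A) u = x + y` for `u` in the domain of the closure; then `x - u` is a generalized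
  -- eigenvector with parameter `1`, hence zero.
  obtain ⟨p, hp, hpu⟩ := hskew.exists_sub_smul_eq G₀.isClosed_topologicalClosure
    (c := -1) (by norm_num) (K := K)
    (fun p hp => K.sub_mem (hGK hp).1 (K.smul_mem _ (hGK hp).2))
    (fun z hz h => eq_zero_of_mem_closure_span hz (hT.inner_eq_zero hb hs0 hs (c := -1)
      (by norm_num) fun n => by
        have h1 := h _ (hgen n)
        simp only [Complex.ofReal_neg, Complex.ofReal_one, neg_smul, one_smul, sub_neg_eq_add,
          inner_add_left] at h1
        push_cast
        linear_combination h1))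
    (u := x + y) (K.add_mem hx hy)
  simp only [Complex.ofReal_neg, Complex.ofReal_one, neg_smul, one_smul, sub_neg_eq_add] at hpu
  have hδ : y - p.2 = -(x - p.1) := by
    rw [← sub_eq_zero, sub_neg_eq_add, ← sub_eq_zero.2 hpu.symm]
    abel
  have hx0 : x - p.1 = 0 := by
    refine eq_zero_of_mem_closure_span (K.sub_mem hx (hGK hp).1)
      (hT.inner_eq_zero hb hs0 hs (c := 1) one_ne_zero fun n => ?_)
    have h1 := hskew _ (hgen n) p hp
    have h2 : ⟪b n, y - p.2⟫_ℂ = -⟪b n, x - p.1⟫_ℂ := by rw [hδ, inner_neg_right]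
    have h3 := hxy n
    simp only [inner_sub_right] at h1 h2 ⊢
    push_cast
    linear_combination h3 - h1 - h2
  have hy0 : y - p.2 = 0 := by rw [hδ, hx0, neg_zero]
  have e : (x, y) = p := Prod.ext (sub_eq_zero.1 hx0) (sub_eq_zero.1 hy0)
  rw [e]
  exact hle hp

/-- The closed span of `b` reduces every skew-adjoint operator that acts on `b` as a Jacobi matrix
with entries of at most linear growth. -/
theorem IsJacobi.reduces [CompleteSpace H] (hT : IsJacobi b T α β s)
    (hb : Orthonormal ℂ b) (hs0 : ∀ n, 0 ≤ s n) (hs : ∀ n, s n ≤ C * (n + 1))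
    {A : H →ₗ.[ℂ] H} (hA : IsSkewAdjoint A) (hTA : ∀ n, (b n, T n) ∈ A.graph)
    {K : ClosedSubmodule ℂ H}
    (hK : K.toSubmodule = (Submodule.span ℂ (Set.range b)).topologicalClosure) :
    Reduces K A := by
  intro x y hxy
  have hcl := hA.isClosed_graph.submodule_topologicalClosure_eq
  rw [← hcl]
  have hbK : ∀ n, b n ∈ K.toSubmodule := fun n => by
    rw [hK]
    exact Submodule.le_topologicalClosure _ (Submodule.subset_span ⟨n, rfl⟩)
  have hTK : ∀ n, T n ∈ K.toSubmodule := by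
    intro n
    cases n with
    | zero =>
      rw [hT.zero]
      exact Submodule.add_mem _ (Submodule.smul_mem _ _ (hbK _)) (Submodule.smul_mem _ _ (hbK _))
    | succ n =>
      rw [hT.succ]
      exact Submodule.sub_mem _ (Submodule.add_mem _ (Submodule.smul_mem _ _ (hbK _))
        (Submodule.smul_mem _ _ (hbK _))) (Submodule.smul_mem _ _ (hbK _))
  have hproj : ∀ w ∈ K.toSubmodule, ∀ v, ⟪w, K.toSubmodule.starProjection v⟫_ℂ = ⟪w, v⟫_ℂ := by
    intro w hw v
    rw [← Submodule.inner_starProjection_left_eq_right,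
      Submodule.starProjection_eq_self_iff.2 hw]
  refine hT.mem_topologicalClosure hb hs0 hs hA.isSkew hTA ?_ ?_ fun n => ?_
  · rw [← hK]
    exact Submodule.starProjection_apply_mem _ _
  · rw [← hK]
    exact Submodule.starProjection_apply_mem _ _
  · rw [hproj _ (hTK n), hproj _ (hbK n)]
    exact hA.isSkew _ (hTA n) _ hxy

/-- If `b` is complete, a skew-symmetric operator that acts on `b` as a Jacobi matrix with entries
of at most linear growth is essentially skew-adjoint, and its closure consists of the weak
solutions of `A x = y`. -/
theorem IsJacobi.isSkewAdjoint_closure [CompleteSpace H] (hT : IsJacobi b T α β s)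
    (hb : Orthonormal ℂ b) (hs0 : ∀ n, 0 ≤ s n) (hs : ∀ n, s n ≤ C * (n + 1))
    (htop : (Submodule.span ℂ (Set.range b)).topologicalClosure = ⊤)
    {A : H →ₗ.[ℂ] H} (hA : IsSkew A.graph) (hTA : ∀ n, (b n, T n) ∈ A.graph) :
    IsSkewAdjoint A.closure ∧
      ∀ x y, (∀ n, ⟪T n, x⟫_ℂ + ⟪b n, y⟫_ℂ = 0) → (x, y) ∈ A.closure.graph := by
  have hweak : ∀ x y, (∀ n, ⟪T n, x⟫_ℂ + ⟪b n, y⟫_ℂ = 0) → (x, y) ∈ A.graph.topologicalClosure :=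
    fun x y h => hT.mem_topologicalClosure hb hs0 hs hA hTA (htop ▸ trivial) (htop ▸ trivial) h
  have hclosable : A.IsClosable := by
    refine ⟨A.graph.topologicalClosure.toLinearPMap, (Submodule.toLinearPMap_graph_eq _ ?_).symm⟩
    intro p hp hp0
    have h : ∀ n, ⟪b n, p.2⟫_ℂ = 0 := by
      intro n
      have h1 := hA.topologicalClosure _ (A.graph.le_topologicalClosure (hTA n)) p hp
      rw [hp0, inner_zero_right, zero_add] at h1
      exact h1
    exact eq_zero_of_mem_closure_span (b := b) (htop ▸ trivial) h
  have hgraph := hclosable.graph_closure_eq_closure_graph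
  rw [hgraph] at hweak
  refine ⟨isSkewAdjoint_of_mem_graph_iff ?_ fun x y => ⟨fun h p hp => ?_, fun h => ?_⟩, hweak⟩
  · refine Submodule.dense_iff_topologicalClosure_eq_top.2 (top_le_iff.1 (htop ▸ ?_))
    refine Submodule.topologicalClosure_mono (Submodule.span_le.2 ?_)
    rintro _ ⟨n, rfl⟩
    exact A.le_closure.1 (LinearPMap.mem_domain_of_mem_graph (hTA n))
  · rw [← hgraph] at h hp
    exact hA.topologicalClosure p hp _ h
  · exact hweak x y fun n => h _ (LinearPMap.le_graph_of_le A.le_closure (hTA n))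

end Jacobi

/-! ### Graphs of sums and multiples of partially defined operators -/

section Graph

variable {H : Type*} [NormedAddCommGroup H] [InnerProductSpace ℂ H]

theorem mem_graph_add_iff {S T : H →ₗ.[ℂ] H} {x y : H} : (x, y) ∈ (S + T).graph ↔
    ∃ u v, (x, u) ∈ S.graph ∧ (x, v) ∈ T.graph ∧ y = u + v := by
  constructor
  · intro h
    obtain ⟨z, hz, hy⟩ := (LinearPMap.mem_graph_iff _).1 h
    simp only at hz hy
    subst hz
    exact ⟨_, _, S.mem_graph ⟨z, z.2.1⟩, T.mem_graph ⟨z, z.2.2⟩, by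
      rw [← hy, LinearPMap.add_apply]⟩
  · rintro ⟨u, v, hu, hv, rfl⟩
    obtain ⟨z, hz, rfl⟩ := (LinearPMap.mem_graph_iff _).1 hu
    obtain ⟨z', hz', rfl⟩ := (LinearPMap.mem_graph_iff _).1 hv
    simp only at hz hz'
    subst hz
    have hzT : (z : H) ∈ T.domain := hz' ▸ z'.2
    obtain rfl : z' = ⟨z, hzT⟩ := Subtype.ext hz'
    exact (LinearPMap.mem_graph_iff _).2 ⟨⟨z, z.2, hzT⟩, rfl, LinearPMap.add_apply _ _ _⟩

theorem mem_graph_smul_iff {T : H →ₗ.[ℂ] H} {c : ℂ} {x y : H} : (x, y) ∈ (c • T).graph ↔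
    ∃ u, (x, u) ∈ T.graph ∧ y = c • u := by
  constructor
  · intro h
    obtain ⟨z, hz, hy⟩ := (LinearPMap.mem_graph_iff _).1 h
    simp only at hz hy
    subst hz
    exact ⟨_, T.mem_graph z, by rw [← hy, LinearPMap.smul_apply]⟩
  · rintro ⟨u, hu, rfl⟩
    obtain ⟨z, hz, rfl⟩ := (LinearPMap.mem_graph_iff _).1 hu
    exact (LinearPMap.mem_graph_iff _).2 ⟨z, hz, LinearPMap.smul_apply _ _ _⟩

theorem mem_graph_sub_iff {S T : H →ₗ.[ℂ] H} {x y : H} : (x, y) ∈ (S - T).graph ↔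
    ∃ u v, (x, u) ∈ S.graph ∧ (x, v) ∈ T.graph ∧ y = u - v := by
  constructor
  · intro h
    obtain ⟨z, hz, hy⟩ := (LinearPMap.mem_graph_iff _).1 h
    simp only at hz hy
    subst hz
    exact ⟨_, _, S.mem_graph ⟨z, z.2.1⟩, T.mem_graph ⟨z, z.2.2⟩, by
      rw [← hy, LinearPMap.sub_apply]⟩
  · rintro ⟨u, v, hu, hv, rfl⟩
    obtain ⟨z, hz, rfl⟩ := (LinearPMap.mem_graph_iff _).1 hu
    obtain ⟨z', hz', rfl⟩ := (LinearPMap.mem_graph_iff _).1 hv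
    simp only at hz hz'
    subst hz
    have hzT : (z : H) ∈ T.domain := hz' ▸ z'.2
    obtain rfl : z' = ⟨z, hzT⟩ := Subtype.ext hz'
    exact (LinearPMap.mem_graph_iff _).2 ⟨⟨z, z.2, hzT⟩, rfl, LinearPMap.sub_apply _ _ _⟩

theorem mem_kernel_iff {T : H →ₗ.[ℂ] H} {x : H} : x ∈ kernel T ↔ (x, 0) ∈ T.graph := by
  rw [LinearPMap.mem_graph_iff]
  constructor
  · rintro ⟨z, hz, rfl⟩
    exact ⟨z, rfl, hz⟩
  · rintro ⟨z, hz, hz0⟩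
    exact ⟨z, hz0, hz⟩

end Graph

namespace UnitaryRep

variable {H : Type*} [NormedAddCommGroup H] [InnerProductSpace ℂ H] [CompleteSpace H]
  (R : UnitaryRep H)

/-! ### Ladder operators on the common invariant domain -/

/-- The restriction of `L₀` to the common invariant domain. -/
noncomputable def l0 : Module.End ℂ R.dom := Complex.I • (R.em - R.ep)

/-- The restriction of `L₊` to the common invariant domain. -/
noncomputable def lp : Module.End ℂ R.dom := (1 / 2 : ℂ) • (R.e0 + Complex.I • (R.ep + R.em))

/-- The restriction of `L₋` to the common invariant domain. -/
noncomputable def lm : Module.End ℂ R.dom := (1 / 2 : ℂ) • (R.e0 - Complex.I • (R.ep + R.em))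

theorem l0_mem_graph (u : R.dom) : ((u : H), (R.l0 u : H)) ∈ R.L0.graph :=
  mem_graph_smul_iff.2 ⟨_, mem_graph_sub_iff.2 ⟨_, _, R.em_eq u, R.ep_eq u, rfl⟩, rfl⟩

theorem lp_mem_graph (u : R.dom) : ((u : H), (R.lp u : H)) ∈ R.Lp.graph :=
  mem_graph_smul_iff.2 ⟨_, mem_graph_add_iff.2 ⟨_, _, R.e0_eq u, mem_graph_smul_iff.2
    ⟨_, mem_graph_add_iff.2 ⟨_, _, R.ep_eq u, R.em_eq u, rfl⟩, rfl⟩, rfl⟩, rfl⟩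

theorem lm_mem_graph (u : R.dom) : ((u : H), (R.lm u : H)) ∈ R.Lm.graph :=
  mem_graph_smul_iff.2 ⟨_, mem_graph_sub_iff.2 ⟨_, _, R.e0_eq u, mem_graph_smul_iff.2
    ⟨_, mem_graph_add_iff.2 ⟨_, _, R.ep_eq u, R.em_eq u, rfl⟩, rfl⟩, rfl⟩, rfl⟩

theorem coe_l0 (u : R.dom) : (R.l0 u : H) = Complex.I • ((R.em u : H) - R.ep u) := rfl

theorem coe_lp (u : R.dom) :
    (R.lp u : H) = (1 / 2 : ℂ) • ((R.e0 u : H) + Complex.I • ((R.ep u : H) + R.em u)) := rfl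

theorem coe_lm (u : R.dom) :
    (R.lm u : H) = (1 / 2 : ℂ) • ((R.e0 u : H) - Complex.I • ((R.ep u : H) + R.em u)) := rfl

/-- `L₀` is symmetric. -/
theorem inner_l0_left (u : R.dom) {x y : H} (h : (x, y) ∈ R.L0.graph) :
    ⟪(R.l0 u : H), x⟫_ℂ = ⟪(u : H), y⟫_ℂ := by
  obtain ⟨w, hw, rfl⟩ := mem_graph_smul_iff.1 h
  obtain ⟨ym, yp, hm, hp, rfl⟩ := mem_graph_sub_iff.1 hw
  have h1 := R.skewAdjoint_Em.isSkew _ (R.em_eq u) _ hm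
  have h2 := R.skewAdjoint_Ep.isSkew _ (R.ep_eq u) _ hp
  simp only [coe_l0, inner_smul_left, inner_smul_right, inner_sub_left, inner_sub_right,
    Complex.conj_I]
  linear_combination -Complex.I * h1 + Complex.I * h2

/-- `-L₋` is a formal adjoint of `L₊`. -/
theorem inner_lm_left (u : R.dom) {x y : H} (h : (x, y) ∈ R.Lp.graph) :
    ⟪(R.lm u : H), x⟫_ℂ = -⟪(u : H), y⟫_ℂ := by
  obtain ⟨w, hw, rfl⟩ := mem_graph_smul_iff.1 h
  obtain ⟨y0, w', h0, hw', rfl⟩ := mem_graph_add_iff.1 hw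
  obtain ⟨w₁, hw₁, rfl⟩ := mem_graph_smul_iff.1 hw'
  obtain ⟨yp, ym, hp, hm, rfl⟩ := mem_graph_add_iff.1 hw₁
  have h1 := R.skewAdjoint_Em.isSkew _ (R.em_eq u) _ hm
  have h2 := R.skewAdjoint_Ep.isSkew _ (R.ep_eq u) _ hp
  have h3 := R.skewAdjoint_E0.isSkew _ (R.e0_eq u) _ h0
  simp only [coe_lm, inner_smul_left, inner_smul_right, inner_sub_left, inner_add_left,
    inner_add_right, Complex.conj_I, map_div₀, map_one, map_ofNat]
  linear_combination (1 / 2) * h3 + (Complex.I / 2) * h1 + (Complex.I / 2) * h2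

/-- `-L₊` is a formal adjoint of `L₋`. -/
theorem inner_lp_left (u : R.dom) {x y : H} (h : (x, y) ∈ R.Lm.graph) :
    ⟪(R.lp u : H), x⟫_ℂ = -⟪(u : H), y⟫_ℂ := by
  obtain ⟨w, hw, rfl⟩ := mem_graph_smul_iff.1 h
  obtain ⟨y0, w', h0, hw', rfl⟩ := mem_graph_sub_iff.1 hw
  obtain ⟨w₁, hw₁, rfl⟩ := mem_graph_smul_iff.1 hw'
  obtain ⟨yp, ym, hp, hm, rfl⟩ := mem_graph_add_iff.1 hw₁
  have h1 := R.skewAdjoint_Em.isSkew _ (R.em_eq u) _ hm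
  have h2 := R.skewAdjoint_Ep.isSkew _ (R.ep_eq u) _ hp
  have h3 := R.skewAdjoint_E0.isSkew _ (R.e0_eq u) _ h0
  simp only [coe_lp, inner_smul_left, inner_smul_right, inner_sub_right, inner_add_left,
    inner_add_right, Complex.conj_I, map_div₀, map_one, map_ofNat]
  linear_combination (1 / 2) * h3 - (Complex.I / 2) * h1 - (Complex.I / 2) * h2

theorem l0_mul_lp : R.l0 * R.lp = R.lp * R.l0 + (2 : ℂ) • R.lp := by
  have h1 : R.e0 * R.ep = R.ep * R.e0 + (2 : ℂ) • R.ep := sub_eq_iff_eq_add'.1 R.lie_e0_ep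
  have h2 : R.e0 * R.em = R.em * R.e0 + -((2 : ℂ) • R.em) := sub_eq_iff_eq_add'.1 R.lie_e0_em
  have h3 : R.ep * R.em = R.em * R.ep + R.e0 := sub_eq_iff_eq_add'.1 R.lie_ep_em
  simp only [l0, lp, mul_add, add_mul, mul_sub, sub_mul, smul_mul_assoc, mul_smul_comm, h1, h2,
    h3]
  match_scalars <;> first | ring1 | (ring_nf; rw [Complex.I_sq]; ring1)

theorem lp_mul_lm : R.lp * R.lm = R.lm * R.lp + R.l0 := by
  have h1 : R.e0 * R.ep = R.ep * R.e0 + (2 : ℂ) • R.ep := sub_eq_iff_eq_add'.1 R.lie_e0_ep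
  have h2 : R.e0 * R.em = R.em * R.e0 + -((2 : ℂ) • R.em) := sub_eq_iff_eq_add'.1 R.lie_e0_em
  have h3 : R.ep * R.em = R.em * R.ep + R.e0 := sub_eq_iff_eq_add'.1 R.lie_ep_em
  simp only [l0, lp, lm, mul_add, add_mul, mul_sub, sub_mul, smul_mul_assoc, mul_smul_comm, h1, h2,
    h3]
  match_scalars <;> ring

theorem l0_mul_lm : R.l0 * R.lm = R.lm * R.l0 - (2 : ℂ) • R.lm := by
  have h1 : R.e0 * R.ep = R.ep * R.e0 + (2 : ℂ) • R.ep := sub_eq_iff_eq_add'.1 R.lie_e0_ep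
  have h2 : R.e0 * R.em = R.em * R.e0 + -((2 : ℂ) • R.em) := sub_eq_iff_eq_add'.1 R.lie_e0_em
  have h3 : R.ep * R.em = R.em * R.ep + R.e0 := sub_eq_iff_eq_add'.1 R.lie_ep_em
  simp only [l0, lm, mul_add, add_mul, mul_sub, sub_mul, smul_mul_assoc, mul_smul_comm, h1, h2,
    h3]
  match_scalars <;> first | ring1 | (ring_nf; rw [Complex.I_sq]; ring1)

end UnitaryRep

namespace UnitaryRep

variable {H : Type*} [NormedAddCommGroup H] [InnerProductSpace ℂ H] [CompleteSpace H]
  {R : UnitaryRep H}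

/-! ### The orthonormal ladder over a lowest weight vector -/

/-- The matrix element `√((n + 1) (n + l))` of `L₊` between the normalized weight vectors of index
`n` and `n + 1`. -/
noncomputable def ladderCoeff (l : ℝ) (n : ℕ) : ℝ := √((n + 1) * (n + l))

theorem ladderCoeff_sq {l : ℝ} (hl : 0 < l) (n : ℕ) :
    ladderCoeff l n ^ 2 = (n + 1) * (n + l) :=
  Real.sq_sqrt (by positivity)

theorem ladderCoeff_pos {l : ℝ} (hl : 0 < l) (n : ℕ) : 0 < ladderCoeff l n :=
  Real.sqrt_pos.2 (by positivity)

theorem ladderCoeff_ne_zero {l : ℝ} (hl : 0 < l) (n : ℕ) : (ladderCoeff l n : ℂ) ≠ 0 := by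
  exact_mod_cast (ladderCoeff_pos hl n).ne'

theorem ladderCoeff_le {l : ℝ} (hl : 0 < l) (n : ℕ) :
    ladderCoeff l n ≤ (1 + l) * (n + 1) := by
  refine Real.sqrt_le_iff.2 ⟨by positivity, ?_⟩
  have hn : (0 : ℝ) ≤ n := n.cast_nonneg
  have h1 : (n : ℝ) + l ≤ (1 + l) * (n + 1) := by nlinarith
  have h2 : (n : ℝ) + 1 ≤ (1 + l) * (n + 1) := by nlinarith
  rw [sq]
  exact mul_le_mul h2 h1 (by positivity) (by positivity)

variable (R) in
/-- An orthonormal sequence of weight vectors in the common invariant domain on which `L₀`, `L₊`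
and `L₋` act as in the lowest weight module of weight `l`. -/
structure IsLadder (l : ℝ) (b : ℕ → R.dom) : Prop where
  pos : 0 < l
  orthonormal : Orthonormal ℂ fun n => (b n : H)
  l0_eq : ∀ n, R.l0 (b n) = ((l + 2 * n : ℝ) : ℂ) • b n
  lp_eq : ∀ n, R.lp (b n) = (ladderCoeff l n : ℂ) • b (n + 1)
  lm_zero : R.lm (b 0) = 0
  lm_succ : ∀ n, R.lm (b (n + 1)) = -((ladderCoeff l n : ℂ) • b n)

theorem mem_kernel_Lm_iff {u : R.dom} : (u : H) ∈ kernel R.Lm ↔ R.lm u = 0 := by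
  rw [mem_kernel_iff]
  constructor
  · intro h
    exact Subtype.ext (R.Lm.mem_graph_snd_inj h (R.lm_mem_graph u) rfl).symm
  · intro h
    have h1 := R.lm_mem_graph u
    rwa [h] at h1

theorem mem_kernel_Lp_iff {u : R.dom} : (u : H) ∈ kernel R.Lp ↔ R.lp u = 0 := by
  rw [mem_kernel_iff]
  constructor
  · intro h
    exact Subtype.ext (R.Lp.mem_graph_snd_inj h (R.lp_mem_graph u) rfl).symm
  · intro h
    have h1 := R.lp_mem_graph u
    rwa [h] at h1

/-- The kernel of `L₋` on the invariant domain is spanned by a weight vector, whose weight is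
positive because `‖L₊ w‖² = l ‖w‖²` and `L₊` is injective. -/
theorem IsLowestWeightType.exists_lowest_weight (hlow : R.IsLowestWeightType) :
    ∃ (l : ℝ) (w : R.dom), 0 < l ∧ ‖(w : H)‖ = 1 ∧ R.lm w = 0 ∧ R.l0 w = (l : ℂ) • w := by
  obtain ⟨w', hw0, hspan⟩ := finrank_eq_one_iff'.1 hlow.finrank_kernel_Lm
  let w : R.dom := ⟨w', w'.2.2⟩
  have hw : (w : H) ≠ 0 := fun h => hw0 (Subtype.ext h)
  have hlm : R.lm w = 0 := mem_kernel_Lm_iff.1 w'.2.1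
  have h1 : R.lm (R.l0 w) = 0 := by
    have h := LinearMap.congr_fun R.l0_mul_lm w
    simp only [Module.End.mul_apply, LinearMap.sub_apply, LinearMap.smul_apply, hlm, map_zero,
      smul_zero, sub_zero] at h
    exact h.symm
  obtain ⟨c, hc⟩ := hspan ⟨R.l0 w, mem_kernel_Lm_iff.2 h1, (R.l0 w).2⟩
  have hcw : R.l0 w = c • w := Subtype.ext (congrArg Subtype.val hc).symm
  have hnorm : ⟪(w : H), (w : H)⟫_ℂ ≠ 0 := inner_self_ne_zero.2 hw
  have hreal : starRingEnd ℂ c = c := by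
    have h := R.inner_l0_left w (R.l0_mem_graph w)
    rw [hcw, Submodule.coe_smul, inner_smul_left, inner_smul_right] at h
    exact mul_right_cancel₀ hnorm h
  have hlp : R.lp w ≠ 0 := by
    intro h
    have h2 : (w : H) ∈ (kernel R.Lp ⊓ R.dom : Submodule ℂ H) := ⟨mem_kernel_Lp_iff.2 h, w.2⟩
    rw [hlow.kernel_Lp] at h2
    exact hw h2
  have hpos : ((‖(R.lp w : H)‖ ^ 2 : ℝ) : ℂ) = c * ((‖(w : H)‖ ^ 2 : ℝ) : ℂ) := by
    have h2 := LinearMap.congr_fun R.lp_mul_lm w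
    simp only [Module.End.mul_apply, LinearMap.add_apply, hlm, map_zero, hcw] at h2
    have h3 := R.inner_lp_left w (R.lm_mem_graph (R.lp w))
    rw [eq_neg_of_add_eq_zero_left h2.symm, Submodule.coe_neg, inner_neg_right, neg_neg,
      Submodule.coe_smul, inner_smul_right, inner_self_eq_norm_sq_to_K,
      inner_self_eq_norm_sq_to_K] at h3
    exact_mod_cast h3
  obtain ⟨l, rfl⟩ := Complex.conj_eq_iff_real.1 hreal
  have hl : 0 < l := by
    have h2 : ‖(R.lp w : H)‖ ^ 2 = l * ‖(w : H)‖ ^ 2 := by exact_mod_cast hpos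
    have h3 : 0 < ‖(R.lp w : H)‖ ^ 2 := by
      have : (R.lp w : H) ≠ 0 := fun h => hlp (Subtype.ext h)
      positivity
    rw [h2] at h3
    exact pos_of_mul_pos_left h3 (by positivity)
  refine ⟨l, ((‖(w : H)‖⁻¹ : ℝ) : ℂ) • w, hl, ?_, ?_, ?_⟩
  · rw [Submodule.coe_smul, norm_smul, Complex.norm_real, norm_inv, norm_norm,
      inv_mul_cancel₀ (norm_ne_zero_iff.2 hw)]
  · rw [map_smul, hlm, smul_zero]
  · rw [map_smul, hcw, smul_comm]

/-- Over a normalized lowest weight vector, `b (n + 1) = L₊ (b n) / √((n + 1) (n + l))` is an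
orthonormal ladder. -/
theorem exists_isLadder_of_lowest_weight {l : ℝ} {w : R.dom} (hl : 0 < l) (hw : ‖(w : H)‖ = 1)
    (hlm : R.lm w = 0) (hl0 : R.l0 w = (l : ℂ) • w) : ∃ b, R.IsLadder l b := by
  obtain ⟨b, hbw, hb⟩ : ∃ b : ℕ → R.dom, b 0 = w ∧
      ∀ n, b (n + 1) = (ladderCoeff l n : ℂ)⁻¹ • R.lp (b n) :=
    ⟨fun n => Nat.rec w (fun k u => (ladderCoeff l k : ℂ)⁻¹ • R.lp u) n, rfl, fun _ => rfl⟩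
  have hlp : ∀ n, R.lp (b n) = (ladderCoeff l n : ℂ) • b (n + 1) := fun n => by
    rw [hb, smul_inv_smul₀ (ladderCoeff_ne_zero hl n)]
  have hb0 : ∀ n, R.l0 (b n) = ((l + 2 * n : ℝ) : ℂ) • b n := by
    intro n
    induction n with
    | zero => simpa [hbw] using hl0
    | succ n ih =>
      have h := LinearMap.congr_fun R.l0_mul_lp (b n)
      simp only [Module.End.mul_apply, LinearMap.add_apply, LinearMap.smul_apply, ih, map_smul]
        at h
      rw [hb, map_smul, h, ← add_smul, smul_comm]
      congr 1
      push_cast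
      ring
  have hsq : ∀ n, (ladderCoeff l n : ℂ) * ladderCoeff l n = (n + 1) * (n + l) := fun n => by
    rw [← sq]
    exact_mod_cast ladderCoeff_sq hl n
  have hstep : ∀ n, R.lp (R.lm (b n)) = -((n * (n - 1 + l) : ℂ) • b n) →
      R.lm (b (n + 1)) = -((ladderCoeff l n : ℂ) • b n) := by
    intro n h1
    have h := LinearMap.congr_fun R.lp_mul_lm (b n)
    simp only [Module.End.mul_apply, LinearMap.add_apply, hb0, h1] at h
    rw [hb, map_smul, inv_smul_eq_iff₀ (ladderCoeff_ne_zero hl n), smul_neg, smul_smul, hsq,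
      ← sub_eq_iff_eq_add.2 h, ← neg_smul, ← neg_smul, ← sub_smul]
    congr 1
    push_cast
    ring
  have hlms : ∀ n, R.lm (b (n + 1)) = -((ladderCoeff l n : ℂ) • b n) := by
    intro n
    induction n with
    | zero => exact hstep 0 (by simp [hbw, hlm])
    | succ n ih =>
      refine hstep (n + 1) ?_
      rw [ih, map_neg, map_smul, hlp, smul_smul, hsq]
      push_cast
      ring_nf
  have hnorm : ∀ n : ℕ, ‖(b n : H)‖ = 1 := by
    intro n
    induction n with
    | zero => rw [hbw, hw]
    | succ n ih =>
      have h := R.inner_lp_left (b n) (R.lm_mem_graph (b (n + 1)))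
      rw [hlp, hlms, Submodule.coe_smul, Submodule.coe_neg, Submodule.coe_smul, inner_neg_right,
        neg_neg, inner_smul_left, inner_smul_right, Complex.conj_ofReal,
        inner_self_eq_norm_sq_to_K, inner_self_eq_norm_sq_to_K, ih] at h
      have h2 := mul_left_cancel₀ (ladderCoeff_ne_zero hl n) h
      have h3 : ‖(b (n + 1) : H)‖ ^ 2 = 1 := by
        have h4 : ((‖(b (n + 1) : H)‖ ^ 2 : ℝ) : ℂ) = 1 := by simpa using h2
        exact_mod_cast h4
      exact (pow_eq_one_iff_of_nonneg (norm_nonneg _) two_ne_zero).1 h3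
  refine ⟨b, hl, ⟨hnorm, fun m n hmn => ?_⟩, hb0, hlp, hbw ▸ hlm, hlms⟩
  have h := R.inner_l0_left (b m) (R.l0_mem_graph (b n))
  rw [hb0, hb0, Submodule.coe_smul, Submodule.coe_smul, inner_smul_left, inner_smul_right,
    Complex.conj_ofReal] at h
  by_contra hne
  have h2 : l + 2 * (m : ℝ) = l + 2 * n := by exact_mod_cast mul_right_cancel₀ hne h
  exact hmn (by exact_mod_cast (by linarith : (m : ℝ) = n))

variable {l : ℝ} {b : ℕ → R.dom}

theorem IsLadder.isJacobi (hb : R.IsLadder l b) (α : ℂ) (β : ℕ → ℝ) :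
    IsJacobi (fun n => (b n : H)) (fun n => α • (R.lp (b n) : H) + (Complex.I * β n) • (b n : H) +
      starRingEnd ℂ α • (R.lm (b n) : H)) α β (ladderCoeff l) where
  zero := by
    rw [hb.lp_eq, hb.lm_zero, Submodule.coe_smul, Submodule.coe_zero, smul_zero, add_zero,
      smul_smul]
  succ n := by
    rw [hb.lp_eq, hb.lm_succ, Submodule.coe_smul, Submodule.coe_neg, Submodule.coe_smul, smul_neg,
      smul_smul, smul_smul, ← sub_eq_add_neg]

/-- For an irreducible representation the ladder is complete: its closed span reduces `E₀`, `E₊` and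
`E₋`, which all act on it as Jacobi matrices. -/
theorem IsLadder.topologicalClosure_eq_top (hb : R.IsLadder l b) (hirr : R.IsIrreducible) :
    (Submodule.span ℂ (Set.range fun n => (b n : H))).topologicalClosure = ⊤ := by
  let K : ClosedSubmodule ℂ H :=
    ⟨(Submodule.span ℂ (Set.range fun n => (b n : H))).topologicalClosure,
      Submodule.isClosed_topologicalClosure _⟩
  -- Here `E₀ = L₊ + L₋` and `E± = (-i (L₊ - L₋) ± i L₀) / 2`, and `L₀` is diagonal on the ladder.
  have h0 : Reduces K R.E0 := by
    refine (hb.isJacobi 1 0).reduces hb.orthonormal (fun n => (ladderCoeff_pos hb.pos n).le)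
      (ladderCoeff_le hb.pos) R.skewAdjoint_E0 (fun n => ?_) rfl
    convert R.e0_eq (b n) using 2
    simp only [coe_lp, coe_lm, map_one, Pi.zero_apply, Complex.ofReal_zero, mul_zero, zero_smul]
    module
  have hp : Reduces K R.Ep := by
    refine (hb.isJacobi (-Complex.I / 2) fun n => (l + 2 * n) / 2).reduces hb.orthonormal
      (fun n => (ladderCoeff_pos hb.pos n).le)
      (ladderCoeff_le hb.pos) R.skewAdjoint_Ep (fun n => ?_) rfl
    convert R.ep_eq (b n) using 2
    have h := congrArg Subtype.val (hb.l0_eq n)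
    rw [coe_l0, Submodule.coe_smul] at h
    have h2 : (Complex.I * (((l + 2 * n) / 2 : ℝ) : ℂ)) • (b n : H) =
        (Complex.I / 2) • (((l + 2 * n : ℝ) : ℂ) • (b n : H)) := by
      rw [smul_smul]
      congr 1
      push_cast
      ring
    simp only [h2, ← h]
    simp only [coe_lp, coe_lm, map_div₀, map_neg, Complex.conj_I, map_ofNat, neg_neg]
    match_scalars <;> first | ring1 | (ring_nf; rw [Complex.I_sq]; ring1)
  have hm : Reduces K R.Em := by
    refine (hb.isJacobi (-Complex.I / 2) fun n => -((l + 2 * n) / 2)).reduces hb.orthonormal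
      (fun n => (ladderCoeff_pos hb.pos n).le)
      (ladderCoeff_le hb.pos) R.skewAdjoint_Em (fun n => ?_) rfl
    convert R.em_eq (b n) using 2
    have h := congrArg Subtype.val (hb.l0_eq n)
    rw [coe_l0, Submodule.coe_smul] at h
    have h2 : (Complex.I * ((-((l + 2 * n) / 2) : ℝ) : ℂ)) • (b n : H) =
        (-Complex.I / 2) • (((l + 2 * n : ℝ) : ℂ) • (b n : H)) := by
      rw [smul_smul]
      congr 1
      push_cast
      ring
    simp only [h2, ← h]
    simp only [coe_lp, coe_lm, map_div₀, map_neg, Complex.conj_I, map_ofNat, neg_neg]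
    match_scalars <;> first | ring1 | (ring_nf; rw [Complex.I_sq]; ring1)
  have hb0 : (b 0 : H) ∈ K.toSubmodule :=
    Submodule.le_topologicalClosure _ (Submodule.subset_span ⟨0, rfl⟩)
  rcases hirr K h0 hp hm with h | h
  · rw [h] at hb0
    exact absurd hb0 (hb.orthonormal.ne_zero 0)
  · exact congrArg ClosedSubmodule.toSubmodule h

variable (hb : R.IsLadder l b)
  (htop : (Submodule.span ℂ (Set.range fun n => (b n : H))).topologicalClosure = ⊤)

include htop in
theorem eq_of_inner_eq {x y : H} (h : ∀ n, ⟪(b n : H), x⟫_ℂ = ⟪(b n : H), y⟫_ℂ) : x = y :=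
  sub_eq_zero.1 (eq_zero_of_mem_closure_span (b := fun n => (b n : H)) (htop ▸ trivial) fun n => by
    rw [inner_sub_right, h, sub_self])

include hb htop

/-- The kernel of `L₋` on its full domain is still spanned by the bottom of the ladder. -/
theorem IsLadder.eq_smul_of_mem_kernel_Lm {v : H} (hv : v ∈ kernel R.Lm) :
    v = ⟪(b 0 : H), v⟫_ℂ • (b 0 : H) := by
  refine eq_of_inner_eq htop fun n => ?_
  cases n with
  | zero => rw [inner_smul_right, inner_self_eq_norm_sq_to_K, hb.orthonormal.1 0]; simp
  | succ n =>
    have h := R.inner_lp_left (b n) (mem_kernel_iff.1 hv)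
    rw [hb.lp_eq, Submodule.coe_smul, inner_smul_left, inner_zero_right, neg_zero,
      Complex.conj_ofReal] at h
    rw [inner_smul_right, hb.orthonormal.2 (Nat.succ_ne_zero n), mul_zero]
    exact (mul_eq_zero.1 h).resolve_left (ladderCoeff_ne_zero hb.pos n)

/-- `L₊` is injective on its full domain. -/
theorem IsLadder.kernel_Lp_eq_bot : kernel R.Lp = ⊥ := by
  refine (Submodule.eq_bot_iff _).2 fun x hx => eq_of_inner_eq htop fun n => ?_
  have h := R.inner_lm_left (b (n + 1)) (mem_kernel_iff.1 hx)
  rw [hb.lm_succ, Submodule.coe_neg, Submodule.coe_smul, inner_neg_left, inner_smul_left,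
    inner_zero_right, neg_zero, neg_eq_zero, Complex.conj_ofReal] at h
  rw [inner_zero_right]
  exact (mul_eq_zero.1 h).resolve_left (ladderCoeff_ne_zero hb.pos n)

omit hb htop

/-! ### The displacement operators -/

theorem dense_domain_Lp (R : UnitaryRep H) : Dense (R.Lp.domain : Set H) :=
  R.dense_dom.mono fun u hu => LinearPMap.mem_domain_of_mem_graph (R.lp_mem_graph ⟨u, hu⟩)

/-- `L₊*` extends the restriction of `-L₋` to the invariant domain. -/
theorem neg_lm_mem_graph_adjoint (u : R.dom) : ((u : H), -(R.lm u : H)) ∈ R.Lp†.graph := by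
  rw [LinearPMap.adjoint_graph_eq_graph_adjoint R.dense_domain_Lp, Submodule.mem_adjoint_iff]
  intro x y hxy
  have h := congrArg (starRingEnd ℂ) (R.inner_lm_left u hxy)
  rw [map_neg, inner_conj_symm, inner_conj_symm] at h
  simp only [inner_neg_right, h]
  ring

theorem isSkew_displacementGenerator (R : UnitaryRep H) (ξ : ℂ) :
    IsSkew (R.displacementGenerator ξ).graph := by
  rintro ⟨x, _⟩ hp ⟨x', _⟩ hq
  obtain ⟨_, _, k1, k2, rfl⟩ := mem_graph_sub_iff.1 hp
  obtain ⟨u, h1, rfl⟩ := mem_graph_smul_iff.1 k1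
  obtain ⟨w, h2, rfl⟩ := mem_graph_smul_iff.1 k2
  obtain ⟨_, _, k1', k2', rfl⟩ := mem_graph_sub_iff.1 hq
  obtain ⟨u', h1', rfl⟩ := mem_graph_smul_iff.1 k1'
  obtain ⟨w', h2', rfl⟩ := mem_graph_smul_iff.1 k2'
  rw [LinearPMap.adjoint_graph_eq_graph_adjoint R.dense_domain_Lp, Submodule.mem_adjoint_iff]
    at h2 h2'
  have h3 := h2 _ _ h1'
  have h4 := congrArg (starRingEnd ℂ) h3
  simp only [map_sub, inner_conj_symm, map_zero] at h4
  have h5 := h2' _ _ h1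
  simp only [inner_sub_left, inner_sub_right, inner_smul_left, inner_smul_right, Complex.conj_conj]
    at h4 h5 ⊢
  linear_combination ξ * h4 + starRingEnd ℂ ξ * h5

theorem mem_graph_displacementGenerator (ξ : ℂ) (u : R.dom) :
    ((u : H), ξ • (R.lp u : H) + starRingEnd ℂ ξ • (R.lm u : H)) ∈
      (R.displacementGenerator ξ).graph :=
  mem_graph_sub_iff.2 ⟨_, _, mem_graph_smul_iff.2 ⟨_, R.lp_mem_graph u, rfl⟩,
    mem_graph_smul_iff.2 ⟨_, neg_lm_mem_graph_adjoint u, rfl⟩, by rw [smul_neg, sub_neg_eq_add]⟩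

include hb htop in
/-- The displacement operator is essentially skew-adjoint, and its closure consists of the weak
solutions on the ladder. -/
theorem IsLadder.isSkewAdjoint_displacementGenerator_closure (ξ : ℂ) :
    IsSkewAdjoint (R.displacementGenerator ξ).closure ∧
      ∀ x y, (∀ n, ⟪ξ • (R.lp (b n) : H) + starRingEnd ℂ ξ • (R.lm (b n) : H), x⟫_ℂ +
        ⟪(b n : H), y⟫_ℂ = 0) → (x, y) ∈ (R.displacementGenerator ξ).closure.graph := by
  have h := (hb.isJacobi ξ 0).isSkewAdjoint_closure hb.orthonormal
    (fun n => (ladderCoeff_pos hb.pos n).le) (ladderCoeff_le hb.pos) htop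
    (R.isSkew_displacementGenerator ξ)
    (fun n => by simpa using mem_graph_displacementGenerator ξ (b n))
  simpa using h

end UnitaryRep

section Product

variable {H : Type*} [NormedAddCommGroup H] [InnerProductSpace ℂ H]

/-! ### The annihilation operator -/

theorem mem_graph_product_iff {S T : H →ₗ.[ℂ] H} {x y : H} : (x, y) ∈ (product S T).graph ↔
    ∃ z, (x, z) ∈ T.graph ∧ (z, y) ∈ S.graph := by
  have happ : ∀ u : (product S T).domain, ∃ z : T.domain, ∃ hz : T z ∈ S.domain,
      (z : H) = u ∧ product S T u = S ⟨T z, hz⟩ := by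
    intro u
    obtain ⟨z, hz, hzu⟩ := u.2.1
    refine ⟨z, hz, hzu, ?_⟩
    have h : (T.domRestrict (productDomain S T)) u = T z := LinearPMap.domRestrict_apply hzu.symm
    change S ⟨(T.domRestrict (productDomain S T)) u, _⟩ = _
    congr 1
    exact Subtype.ext h
  constructor
  · intro h
    obtain ⟨u, hu, hy⟩ := (LinearPMap.mem_graph_iff _).1 h
    obtain ⟨z, hz, hzu, hS⟩ := happ u
    simp only at hu hy
    refine ⟨T z, ?_, ?_⟩
    · rw [← hu, ← hzu]
      exact T.mem_graph z
    · rw [← hy, hS]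
      exact S.mem_graph ⟨T z, hz⟩
  · rintro ⟨z, hT, hS⟩
    obtain ⟨u, hu, huz⟩ := (LinearPMap.mem_graph_iff _).1 hT
    obtain ⟨v, hv, hvy⟩ := (LinearPMap.mem_graph_iff _).1 hS
    simp only at hu huz hv hvy
    subst hu
    have hmem : T u ∈ S.domain := by
      rw [huz, ← hv]
      exact v.2
    have hdom : (u : H) ∈ (product S T).domain := ⟨⟨u, hmem, rfl⟩, u.2⟩
    obtain ⟨w, hw, hwu, hSw⟩ := happ ⟨u, hdom⟩
    refine (LinearPMap.mem_graph_iff _).2 ⟨⟨u, hdom⟩, rfl, ?_⟩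
    obtain rfl : w = u := Subtype.ext hwu
    rw [hSw, ← hvy]
    congr 1
    exact Subtype.ext (huz.trans hv.symm)

theorem mem_graph_inverse_iff {T : H →ₗ.[ℂ] H} (hT : kernel T = ⊥) {x y : H} :
    (x, y) ∈ T.inverse.graph ↔ (y, x) ∈ T.graph := by
  have hker : LinearMap.ker T.toFun = ⊥ :=
    Submodule.map_injective_of_injective (Submodule.subtype_injective _)
      (hT.trans (Submodule.map_bot _).symm)
  rw [LinearPMap.inverse_graph hker]
  constructor
  · rintro ⟨⟨u, v⟩, h, hxy⟩
    obtain ⟨rfl, rfl⟩ := Prod.mk.inj hxy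
    exact h
  · exact fun h => ⟨(y, x), h, rfl⟩

theorem mem_graph_toPMap_top_iff {f : H →ₗ[ℂ] H} {x y : H} :
    (x, y) ∈ (f.toPMap ⊤).graph ↔ y = f x := by
  rw [LinearPMap.mem_graph_iff]
  constructor
  · rintro ⟨z, rfl, rfl⟩
    rfl
  · rintro rfl
    exact ⟨⟨x, trivial⟩, rfl, rfl⟩

variable [CompleteSpace H]

/-- A weighted backward shift with bounded weights is a bounded operator; continuity follows from
the closed graph theorem. -/
theorem exists_weighted_shift {b : ℕ → H} (hb : Orthonormal ℂ b)
    (htop : (Submodule.span ℂ (Set.range b)).topologicalClosure = ⊤) {m : ℕ → ℂ} {M : ℝ}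
    (hm : ∀ n, ‖m n‖ ^ 2 ≤ M) :
    ∃ a : H →L[ℂ] H, ∀ x n, ⟪b n, a x⟫_ℂ = m n * ⟪b (n + 1), x⟫_ℂ := by
  have hext : ∀ {x y : H}, (∀ n, ⟪b n, x⟫_ℂ = ⟪b n, y⟫_ℂ) → x = y := fun {x y} h =>
    sub_eq_zero.1 (eq_zero_of_mem_closure_span (b := b) (htop ▸ trivial) fun n => by
      rw [inner_sub_right, h, sub_self])
  let B : HilbertBasis ℕ ℂ H := HilbertBasis.mk hb htop.ge
  have hex : ∀ x, ∃ y, ∀ n, ⟪b n, y⟫_ℂ = m n * ⟪b (n + 1), x⟫_ℂ := by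
    intro x
    have hsum : Memℓp (fun n => m n * ⟪b (n + 1), x⟫_ℂ) 2 := by
      refine memℓp_gen ?_
      have h1 := (summable_nat_add_iff 1).2 (hb.inner_products_summable x)
      refine Summable.of_nonneg_of_le (fun n => by positivity) (fun n => ?_) (h1.mul_left M)
      simp only [ENNReal.toReal_ofNat, Real.rpow_ofNat, norm_mul, mul_pow]
      exact mul_le_mul_of_nonneg_right (hm n) (by positivity)
    refine ⟨B.repr.symm ⟨_, hsum⟩, fun n => ?_⟩
    have h := B.repr_apply_apply (B.repr.symm ⟨_, hsum⟩) n
    rw [LinearIsometryEquiv.apply_symm_apply] at h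
    rw [show B n = b n by simp [B]] at h
    exact h.symm
  choose f hf using hex
  let a₀ : H →ₗ[ℂ] H :=
    { toFun := f
      map_add' := fun x y => hext fun n => by
        rw [hf, inner_add_right, inner_add_right, hf, hf, mul_add]
      map_smul' := fun c x => hext fun n => by
        rw [hf, RingHom.id_apply, inner_smul_right, inner_smul_right, hf]
        ring }
  have hcont : Continuous a₀ := by
    refine a₀.continuous_of_seq_closed_graph fun u x y hu hau => hext fun n => ?_
    change _ = ⟪b n, f x⟫_ℂ
    rw [hf]
    refine tendsto_nhds_unique (tendsto_const_nhds.inner hau) ?_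
    have h1 : (fun k => ⟪b n, (a₀ ∘ u) k⟫_ℂ) = fun k => m n * ⟪b (n + 1), u k⟫_ℂ :=
      funext fun k => hf (u k) n
    rw [h1]
    exact (tendsto_const_nhds.inner hu).const_mul _
  exact ⟨⟨a₀, hcont⟩, fun x n => hf x n⟩

end Product

namespace UnitaryRep

variable {H : Type*} [NormedAddCommGroup H] [InnerProductSpace ℂ H] [CompleteSpace H]
  {R : UnitaryRep H} {l : ℝ} {b : ℕ → R.dom}

theorem mem_graph_number_iff {x y : H} : (x, y) ∈ (R.number l).graph ↔
    ∃ w, (x, w) ∈ R.L0.graph ∧ y = (1 / 2 : ℂ) • (w - (l : ℂ) • x) := by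
  unfold number
  rw [mem_graph_smul_iff]
  constructor
  · rintro ⟨u, hu, rfl⟩
    obtain ⟨w, v, hw, hv, rfl⟩ := mem_graph_sub_iff.1 hu
    rw [mem_graph_toPMap_top_iff.1 hv]
    exact ⟨w, hw, rfl⟩
  · rintro ⟨w, hw, rfl⟩
    exact ⟨_, mem_graph_sub_iff.2 ⟨w, _, hw, mem_graph_toPMap_top_iff.2 rfl, rfl⟩, rfl⟩

/-- The annihilation operator is the bounded operator which maps `b (n + 1)` to
`((n + 1) / √((n + 1) (n + l))) • b n` and annihilates `b 0`. -/
theorem IsLadder.exists_annihilation_eq (hb : R.IsLadder l b)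
    (htop : (Submodule.span ℂ (Set.range fun n => (b n : H))).topologicalClosure = ⊤) :
    ∃ a : H →L[ℂ] H, R.annihilation l = (a : H →ₗ[ℂ] H).toPMap ⊤ ∧
      ∀ x n, ⟪(b n : H), a x⟫_ℂ =
        ((n + 1) / (ladderCoeff l n : ℂ)) * ⟪(b (n + 1) : H), x⟫_ℂ := by
  have hl := hb.pos
  have hs := ladderCoeff_ne_zero hl
  obtain ⟨a, ha⟩ := exists_weighted_shift hb.orthonormal htop
    (m := fun n => (n + 1) / (ladderCoeff l n : ℂ)) (M := 1 + 1 / l) fun n => by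
      have h1 : ‖((n : ℂ) + 1) / (ladderCoeff l n : ℂ)‖ ^ 2 = (n + 1) / (n + l) := by
        have h2 : ((n : ℂ) + 1) / (ladderCoeff l n : ℂ) =
            ((((n : ℝ) + 1) / ladderCoeff l n : ℝ) : ℂ) := by push_cast; rfl
        rw [h2, Complex.norm_real, Real.norm_eq_abs, sq_abs, div_pow, ladderCoeff_sq hl]
        field_simp
      rw [h1, div_le_iff₀ (by positivity)]
      have e : (1 + 1 / l) * ((n : ℝ) + l) = n + 1 + (l + n / l) := by field_simp; ring
      rw [e]
      linarith [show 0 ≤ l + n / l by positivity]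
  refine ⟨a, ?_, ha⟩
  have hker := hb.kernel_Lp_eq_bot htop
  have hprod : ∀ {x y : H}, (x, y) ∈ (product R.Lp.inverse (R.number l)).graph ↔
      ∃ z, (x, z) ∈ (R.number l).graph ∧ (y, z) ∈ R.Lp.graph := by
    intro x y
    simp only [mem_graph_product_iff, mem_graph_inverse_iff hker]
  have hle : (product R.Lp.inverse (R.number l)).graph ≤ ((a : H →ₗ[ℂ] H).toPMap ⊤).graph := by
    rintro ⟨x, y⟩ hxy
    obtain ⟨z, hz, hyz⟩ := hprod.1 hxy
    obtain ⟨w, hw, rfl⟩ := mem_graph_number_iff.1 hz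
    refine mem_graph_toPMap_top_iff.2 (eq_of_inner_eq htop fun n => ?_)
    have h1 := R.inner_l0_left (b (n + 1)) hw
    have h2 := R.inner_lm_left (b (n + 1)) hyz
    rw [hb.l0_eq, Submodule.coe_smul, inner_smul_left, Complex.conj_ofReal] at h1
    rw [hb.lm_succ, Submodule.coe_neg, Submodule.coe_smul, inner_neg_left, inner_smul_left,
      Complex.conj_ofReal, neg_inj, inner_smul_right, inner_sub_right, ← h1, inner_smul_right] at h2
    change _ = ⟪(b n : H), a x⟫_ℂ
    rw [ha, div_mul_eq_mul_div, eq_div_iff (hs n), mul_comm, h2]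
    push_cast
    ring
  have hclosed : IsClosed (((a : H →ₗ[ℂ] H).toPMap ⊤).graph : Set (H × H)) := by
    have : (((a : H →ₗ[ℂ] H).toPMap ⊤).graph : Set (H × H)) = {p | p.2 = a p.1} := by
      ext ⟨x, y⟩
      exact mem_graph_toPMap_top_iff
    rw [this]
    exact isClosed_eq continuous_snd (a.continuous.comp continuous_fst)
  have hab0 : a (b 0) = 0 := eq_of_inner_eq htop fun n => by
    rw [ha, inner_zero_right, hb.orthonormal.2 (Nat.succ_ne_zero n), mul_zero]
  have hab : ∀ n, a (b (n + 1)) = (((n : ℂ) + 1) / (ladderCoeff l n : ℂ)) • (b n : H) := by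
    intro n
    refine eq_of_inner_eq htop fun k => ?_
    rw [ha, inner_smul_right]
    by_cases hkn : k = n
    · subst hkn
      rw [inner_self_eq_norm_sq_to_K, inner_self_eq_norm_sq_to_K, hb.orthonormal.1,
        hb.orthonormal.1]
    · rw [hb.orthonormal.2 (fun h => hkn (Nat.succ_injective h)), hb.orthonormal.2 hkn, mul_zero,
        mul_zero]
  have hgen : ∀ n, ((b n : H), a (b n)) ∈ (product R.Lp.inverse (R.number l)).graph := by
    intro n
    refine hprod.2 ?_
    have hnum := (mem_graph_number_iff (l := l)).2 ⟨_, R.l0_mem_graph (b n), rfl⟩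
    refine ⟨_, hnum, ?_⟩
    rw [hb.l0_eq, Submodule.coe_smul, ← sub_smul, smul_smul]
    cases n with
    | zero =>
      rw [hab0]
      simp
    | succ n =>
      have h1 := R.Lp.graph.smul_mem (((n : ℂ) + 1) / (ladderCoeff l n : ℂ))
        (R.lp_mem_graph (b n))
      rw [hb.lp_eq, Submodule.coe_smul, Prod.smul_mk, smul_smul, div_mul_cancel₀ _ (hs n)] at h1
      rw [hab]
      convert h1 using 3
      push_cast
      ring
  have hcl : (product R.Lp.inverse (R.number l)).graph.topologicalClosure =
      ((a : H →ₗ[ℂ] H).toPMap ⊤).graph := by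
    refine le_antisymm (Submodule.topologicalClosure_minimal _ hle hclosed) ?_
    rintro ⟨x, y⟩ hxy
    rw [mem_graph_toPMap_top_iff] at hxy
    subst hxy
    let Φ : H →L[ℂ] H × H := (ContinuousLinearMap.id ℂ H).prod a
    have h1 : (⊤ : Submodule ℂ H) ≤
        (product R.Lp.inverse (R.number l)).graph.topologicalClosure.comap Φ.toLinearMap := by
      rw [← htop]
      refine Submodule.topologicalClosure_minimal _ (Submodule.span_le.2 ?_)
        ((Submodule.isClosed_topologicalClosure _).preimage Φ.continuous)
      rintro _ ⟨n, rfl⟩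
      exact Submodule.le_topologicalClosure _ (hgen n)
    exact h1 (show x ∈ ⊤ from trivial)
  have hclosable : (product R.Lp.inverse (R.number l)).IsClosable := ⟨_, hcl⟩
  exact LinearPMap.eq_of_eq_graph (hclosable.graph_closure_eq_closure_graph.symm.trans hcl)

/-! ### Coherent vectors -/

/-- The coefficient `√(l (l + 1) ⋯ (l + n - 1) / n!)` of the coherent vectors. -/
noncomputable def coherentCoeff (l : ℝ) (n : ℕ) : ℝ :=
  ∏ k ∈ Finset.range n, ladderCoeff l k / (k + 1)

theorem coherentCoeff_zero (l : ℝ) : coherentCoeff l 0 = 1 := by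
  simp [coherentCoeff]

theorem coherentCoeff_pos (hl : 0 < l) (n : ℕ) : 0 < coherentCoeff l n :=
  Finset.prod_pos fun k _ => div_pos (ladderCoeff_pos hl k) (by positivity)

theorem coherentCoeff_succ (l : ℝ) (n : ℕ) :
    (n + 1) * coherentCoeff l (n + 1) = coherentCoeff l n * ladderCoeff l n := by
  rw [coherentCoeff, Finset.prod_range_succ, ← coherentCoeff]
  field_simp

theorem ladderCoeff_mul_coherentCoeff_succ (hl : 0 < l) (n : ℕ) :
    ladderCoeff l n * coherentCoeff l (n + 1) = (n + l) * coherentCoeff l n := by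
  have h1 := coherentCoeff_succ l n
  have h2 := ladderCoeff_sq hl n
  have hn : (n : ℝ) + 1 ≠ 0 := by positivity
  refine mul_left_cancel₀ hn ?_
  linear_combination ladderCoeff l n * h1 + coherentCoeff l n * h2

/-- The ratio of consecutive coherent coefficients tends to `1`, so their power series and its
derivative converge in the unit disc. -/
theorem summable_coherentCoeff (hl : 0 < l) {r : ℝ} (hr0 : 0 < r) (hr : r < 1) :
    Summable fun n : ℕ => (n * r ^ (n - 1)) * coherentCoeff l n := by
  obtain ⟨q, hrq, hq⟩ := exists_between hr
  obtain ⟨N, hN⟩ := exists_nat_ge (r * (1 + l) / (q - r))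
  refine summable_of_ratio_norm_eventually_le hq ?_
  filter_upwards [eventually_ge_atTop (N + 1)] with n hn
  have hd := coherentCoeff_pos hl n
  have hd' := coherentCoeff_pos hl (n + 1)
  rw [Real.norm_of_nonneg (by positivity), Real.norm_of_nonneg (by positivity)]
  have hs : ladderCoeff l n ≤ n + 1 + l := by
    refine Real.sqrt_le_iff.2 ⟨by positivity, ?_⟩
    have : (0 : ℝ) ≤ n := n.cast_nonneg
    nlinarith
  have hn' : r * (1 + l) ≤ n * (q - r) := by
    have h1 : (N : ℝ) ≤ n := by exact_mod_cast (by omega : N ≤ n)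
    exact (div_le_iff₀ (by linarith)).1 (hN.trans h1)
  obtain ⟨m, rfl⟩ : ∃ m, n = m + 1 := ⟨n - 1, by omega⟩
  have h1 := coherentCoeff_succ l (m + 1)
  have e1 : ((m + 1 + 1 : ℕ) : ℝ) * r ^ (m + 1 + 1 - 1) * coherentCoeff l (m + 1 + 1) =
      r ^ (m + 1) * (coherentCoeff l (m + 1) * ladderCoeff l (m + 1)) := by
    rw [← h1, Nat.add_sub_cancel]
    push_cast
    ring
  rw [e1, Nat.add_sub_cancel]
  have hpos : 0 ≤ r ^ m * coherentCoeff l (m + 1) := by positivity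
  have h2 : r * ladderCoeff l (m + 1) ≤ q * ((m + 1 : ℕ) : ℝ) := by
    have := mul_le_mul_of_nonneg_left hs hr0.le
    linarith
  calc r ^ (m + 1) * (coherentCoeff l (m + 1) * ladderCoeff l (m + 1))
      = (r ^ m * coherentCoeff l (m + 1)) * (r * ladderCoeff l (m + 1)) := by ring
    _ ≤ (r ^ m * coherentCoeff l (m + 1)) * (q * ((m + 1 : ℕ) : ℝ)) :=
        mul_le_mul_of_nonneg_left h2 hpos
    _ = _ := by ring

/-- The unnormalized coherent vectors `F z = ∑ z ^ n • (coherentCoeff l n • b n)` form a holomorphic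
family on the unit disc. -/
theorem IsLadder.exists_coherent_family (hb : R.IsLadder l b) :
    ∃ F F' : ℂ → H, ∀ z : ℂ, ‖z‖ < 1 → HasDerivAt F (F' z) z ∧ ∀ n,
      ⟪(b n : H), F z⟫_ℂ = coherentCoeff l n * z ^ n ∧
      ⟪(b n : H), F' z⟫_ℂ = coherentCoeff l n * (n * z ^ (n - 1)) := by
  let g : ℕ → ℂ → H := fun n z => z ^ n • ((coherentCoeff l n : ℂ) • (b n : H))
  let g' : ℕ → ℂ → H := fun n z => (n * z ^ (n - 1)) • ((coherentCoeff l n : ℂ) • (b n : H))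
  have hF : ∀ z : ℂ, ‖z‖ < 1 → HasDerivAt (fun z => ∑' n, g n z) (∑' n, g' n z) z ∧
      ∀ n, ⟪(b n : H), ∑' n, g n z⟫_ℂ = coherentCoeff l n * z ^ n := by
    intro z hz
    obtain ⟨r, hzr, hr⟩ := exists_between hz
    have hr0 : 0 < r := (norm_nonneg z).trans_lt hzr
    have hu := summable_coherentCoeff hb.pos hr0 hr
    have hd : ∀ n y, y ∈ Metric.ball (0 : ℂ) r → HasDerivAt (g n) (g' n y) y :=
      fun n y _ => (hasDerivAt_pow n y).smul_const _
    have hbd : ∀ n y, y ∈ Metric.ball (0 : ℂ) r →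
        ‖g' n y‖ ≤ (n * r ^ (n - 1)) * coherentCoeff l n := by
      intro n y hy
      rw [mem_ball_zero_iff] at hy
      have hc := coherentCoeff_pos hb.pos n
      simp only [g', norm_smul, norm_mul, norm_pow, Complex.norm_natCast, Complex.norm_real,
        Real.norm_of_nonneg hc.le]
      rw [hb.orthonormal.1 n, mul_one]
      gcongr
    have hpre : IsPreconnected (Metric.ball (0 : ℂ) r) := (convex_ball _ _).isPreconnected
    have h0 : (0 : ℂ) ∈ Metric.ball (0 : ℂ) r := Metric.mem_ball_self hr0
    have hz' : z ∈ Metric.ball (0 : ℂ) r := mem_ball_zero_iff.2 hzr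
    have hg0 : Summable fun n => g n 0 := by
      refine summable_of_ne_finset_zero (s := {0}) fun n hn => ?_
      have : n ≠ 0 := by simpa using hn
      simp [g, this]
    refine ⟨hasDerivAt_tsum_of_isPreconnected hu Metric.isOpen_ball hpre hd hbd h0 hg0 hz', ?_⟩
    have hs : Summable fun n => g n z :=
      summable_of_summable_hasDerivAt_of_isPreconnected hu Metric.isOpen_ball hpre hd hbd h0 hg0 hz'
    intro n
    have h1 := (innerSL ℂ (b n : H)).map_tsum hs
    simp only [innerSL_apply_apply] at h1
    rw [h1, tsum_eq_single n]
    · simp only [g, inner_smul_right]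
      rw [inner_self_eq_norm_sq_to_K, hb.orthonormal.1 n]
      simp [mul_comm]
    · intro m hm
      simp only [g, inner_smul_right]
      rw [hb.orthonormal.2 hm.symm, mul_zero, mul_zero]
  refine ⟨fun z => ∑' n, g n z, fun z => ∑' n, g' n z, fun z hz => ⟨(hF z hz).1, fun n =>
    ⟨(hF z hz).2 n, ?_⟩⟩⟩
  have h1 : HasDerivAt (fun w => ⟪(b n : H), ∑' n, g n w⟫_ℂ) ⟪(b n : H), ∑' n, g' n z⟫_ℂ z :=
    (innerSL ℂ (b n : H)).hasFDerivAt.comp_hasDerivAt z (hF z hz).1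
  have h2 : HasDerivAt (fun w : ℂ => (coherentCoeff l n : ℂ) * w ^ n)
      (coherentCoeff l n * (n * z ^ (n - 1))) z := (hasDerivAt_pow n z).const_mul _
  refine h1.unique (h2.congr_of_eventuallyEq ?_)
  have hmem : Metric.ball (0 : ℂ) 1 ∈ 𝓝 z :=
    Metric.isOpen_ball.mem_nhds (mem_ball_zero_iff.2 hz)
  filter_upwards [hmem] with w hw
  exact (hF w (mem_ball_zero_iff.1 hw)).2 n

theorem hasDerivAt_tanh_mul (ρ t : ℝ) :
    HasDerivAt (fun s : ℝ => Real.tanh (ρ * s)) (ρ * (1 - Real.tanh (ρ * t) ^ 2)) t := by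
  have hc := (Real.cosh_pos (ρ * t)).ne'
  have hm : HasDerivAt (fun s : ℝ => ρ * s) ρ t := by
    simpa using (hasDerivAt_id t).const_mul ρ
  have h := hm.sinh.div hm.cosh hc
  have e : (fun s : ℝ => Real.tanh (ρ * s)) =
      (fun s : ℝ => Real.sinh (ρ * s)) / fun s : ℝ => Real.cosh (ρ * s) := by
    funext s
    exact Real.tanh_eq_sinh_div_cosh _
  rw [e]
  refine h.congr_deriv ?_
  rw [Real.tanh_eq_sinh_div_cosh]
  field_simp

/-- The orbit of the lowest weight vector under the displacement group: with `ξ = ρ e`, `|e| = 1`,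
the curve `t ↦ cosh (ρ t) ^ (-l) • F (e tanh (ρ t))` solves `ψ' = A ψ` for the generator `A`, hence
is the orbit. -/
theorem IsLadder.exists_displacement_orbit (hb : R.IsLadder l b)
    (htop : (Submodule.span ℂ (Set.range fun n => (b n : H))).topologicalClosure = ⊤)
    {e : ℂ} (he : ‖e‖ = 1) (ρ : ℝ) :
    ∃ (c : ℂ) (x : H), R.U (ρ * e) (b 0) = c • x ∧
      ∀ n, ⟪(b n : H), x⟫_ℂ = coherentCoeff l n * (e * (Real.tanh ρ : ℝ)) ^ n := by
  obtain ⟨hskew, hweak⟩ := hb.isSkewAdjoint_displacementGenerator_closure htop (ρ * e)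
  obtain ⟨V, hV, hVU⟩ := exists_isGenerator_and_unitaryExp_eq
    (isExponentiable_of_isSkewAdjoint_closure hskew)
  obtain ⟨F, F', hF⟩ := hb.exists_coherent_family
  have hee : starRingEnd ℂ e * e = 1 := by
    rw [← Complex.normSq_eq_conj_mul_self, Complex.normSq_eq_norm_sq, he]
    simp
  let r : ℝ → ℝ := fun t => Real.tanh (ρ * t)
  let z : ℝ → ℂ := fun t => e * (r t : ℂ)
  let p : ℝ → ℝ := fun t => Real.exp (-l * Real.log (Real.cosh (ρ * t)))
  have hz : ∀ t, ‖z t‖ < 1 := fun t => by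
    rw [norm_mul, he, one_mul, Complex.norm_real, Real.norm_eq_abs]
    exact Real.abs_tanh_lt_one _
  have hzd : ∀ t, HasDerivAt z (e * ((ρ * (1 - r t ^ 2) : ℝ) : ℂ)) t := fun t =>
    (hasDerivAt_tanh_mul ρ t).ofReal_comp.const_mul e
  have hpd : ∀ t, HasDerivAt p (-(l * ρ * r t * p t)) t := by
    intro t
    have hm : HasDerivAt (fun s : ℝ => ρ * s) ρ t := by
      simpa using (hasDerivAt_id t).const_mul ρ
    have h := ((hm.cosh.log (Real.cosh_pos (ρ * t)).ne').const_mul (-l)).exp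
    refine h.congr_deriv ?_
    simp only [r, p, Real.tanh_eq_sinh_div_cosh]
    ring
  let ψ : ℝ → H := fun t => (p t : ℂ) • F (z t)
  let ψ' : ℝ → H := fun t => (p t : ℂ) • ((e * ((ρ * (1 - r t ^ 2) : ℝ) : ℂ)) • F' (z t)) +
    ((-(l * ρ * r t * p t) : ℝ) : ℂ) • F (z t)
  have hψ : ∀ t, HasDerivAt ψ (ψ' t) t := fun t =>
    (hpd t).ofReal_comp.smul ((hF (z t) (hz t)).1.scomp t (hzd t))
  have hψG : ∀ t, (ψ t, ψ' t) ∈ (R.displacementGenerator (ρ * e)).closure.graph := by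
    refine fun t => hweak _ _ fun n => ?_
    have hF1 := fun n => ((hF (z t) (hz t)).2 n).1
    have hF2 := fun n => ((hF (z t) (hz t)).2 n).2
    have hd := fun n => congrArg (fun x : ℝ => (x : ℂ)) (coherentCoeff_succ l n)
    have hd' := fun n => congrArg (fun x : ℝ => (x : ℂ))
      (ladderCoeff_mul_coherentCoeff_succ hb.pos n)
    simp only [Complex.ofReal_mul, Complex.ofReal_add, Complex.ofReal_natCast,
      Complex.ofReal_one] at hd hd'
    cases n with
    | zero =>
      have hd0 := hd' 0
      rw [coherentCoeff_zero] at hd0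
      simp only [hb.lp_eq, hb.lm_zero, Submodule.coe_smul, Submodule.coe_zero, smul_zero, add_zero,
        ψ, ψ', inner_add_right, inner_smul_left, inner_smul_right, hF1, hF2, coherentCoeff_zero,
        z, map_mul, Complex.conj_ofReal]
      push_cast at hd0 ⊢
      simp only [zero_add, pow_zero, pow_one, mul_one, mul_zero] at hd0 ⊢
      linear_combination (ρ * p t * r t : ℂ) * (starRingEnd ℂ e * e) * hd0 +
        (ρ * p t * r t * l : ℂ) * hee
    | succ n =>
      have h1 := hd n
      have h2 := hd' (n + 1)
      simp only [hb.lp_eq, hb.lm_succ, Submodule.coe_smul, Submodule.coe_neg, smul_neg,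
        ψ, ψ', inner_add_right, inner_add_left, inner_neg_left, inner_smul_left, inner_smul_right,
        hF1, hF2, map_mul, Complex.conj_ofReal, Complex.conj_conj, Nat.add_sub_cancel]
      simp only [z, mul_pow]
      push_cast at h2 ⊢
      linear_combination (ρ * starRingEnd ℂ e * p t * e ^ (n + 2) * r t ^ (n + 2) : ℂ) * h2 +
        (ρ * p t * e ^ (n + 1) * r t ^ n : ℂ) * h1 +
        (ρ * p t * (n + 1 + l) * coherentCoeff l (n + 1) * e ^ (n + 1) * r t ^ (n + 2) : ℂ) * hee
  have h0 : V.toFun 0 (b 0 : H) = ψ 0 := by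
    rw [V.map_zero]
    refine eq_of_inner_eq htop fun n => ?_
    have hz0 : z 0 = 0 := by simp [z, r]
    have hp0 : p 0 = 1 := by simp [p]
    simp only [ψ, hz0, hp0, Complex.ofReal_one, one_smul]
    rw [((hF 0 (by simp)).2 n).1]
    cases n with
    | zero => rw [inner_self_eq_norm_sq_to_K, hb.orthonormal.1 0, coherentCoeff_zero]; simp
    | succ n => rw [hb.orthonormal.2 (Nat.succ_ne_zero n)]; simp
  have hmem := LinearPMap.le_graph_of_le (LinearPMap.le_closure _)
    (mem_graph_displacementGenerator (ρ * e) (b 0))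
  refine ⟨p 1, F (z 1), ?_, fun n => ?_⟩
  · have h := hskew.isSkew.eq_of_hasDerivAt (fun t => (hV.orbit hmem t).2)
      (fun t => (hV.orbit hmem t).1) hψ hψG h0 1
    rw [U, hVU]
    exact h
  · rw [((hF _ (hz 1)).2 n).1]
    simp [z, r]

end UnitaryRep

end SU11

theorem mainTheorem12 {H : Type*} [NormedAddCommGroup H] [InnerProductSpace ℂ H]
    [CompleteSpace H] (R : SU11.UnitaryRep H) (hirr : R.IsIrreducible)
    (hlow : R.IsLowestWeightType) (v₀ : H) (hv₀ : v₀ ∈ SU11.kernel R.Lm) (hnorm : ‖v₀‖ = 1) :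
    ∃ l : ℝ, 0 < l ∧ (v₀, (l : ℂ) • v₀) ∈ R.L0.graph ∧
      SU11.kernel R.Lp = ⊥ ∧
      (∀ ξ : ℂ, SU11.IsExponentiable (R.displacementGenerator ξ)) ∧
      ∃ a : H →L[ℂ] H, R.annihilation l = (a : H →ₗ[ℂ] H).toPMap ⊤ ∧
        ∀ ζ : ℂ, ‖ζ‖ < 1 →
          R.coherentState v₀ ζ ≠ 0 ∧ a (R.coherentState v₀ ζ) = ζ • R.coherentState v₀ ζ := by
  obtain ⟨l, w, hl, hw, hlm, hl0⟩ := hlow.exists_lowest_weight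
  obtain ⟨b, hb⟩ := SU11.UnitaryRep.exists_isLadder_of_lowest_weight hl hw hlm hl0
  have htop := hb.topologicalClosure_eq_top hirr
  obtain ⟨c, rfl⟩ : ∃ c : ℂ, v₀ = c • (b 0 : H) := ⟨_, hb.eq_smul_of_mem_kernel_Lm htop hv₀⟩
  obtain ⟨a, hann, ha⟩ := hb.exists_annihilation_eq htop
  refine ⟨l, hl, ?_, hb.kernel_Lp_eq_bot htop, fun ξ =>
    SU11.isExponentiable_of_isSkewAdjoint_closure
      (hb.isSkewAdjoint_displacementGenerator_closure htop ξ).1, a, hann, fun ζ hζ => ⟨?_, ?_⟩⟩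
  · have h := R.L0.graph.smul_mem c (R.l0_mem_graph (b 0))
    rw [hb.l0_eq, Submodule.coe_smul, Prod.smul_mk, smul_comm] at h
    simpa using h
  · rw [← norm_ne_zero_iff, SU11.UnitaryRep.coherentState, LinearIsometryEquiv.norm_map, hnorm]
    exact one_ne_zero
  · have he : ‖Complex.exp (Complex.I * (Complex.arg ζ : ℂ))‖ = 1 := by
      rw [mul_comm, Complex.norm_exp_ofReal_mul_I]
    have hζ' : ‖ζ‖ ∈ Set.Ioo (-1 : ℝ) 1 := ⟨by linarith [norm_nonneg ζ], hζ⟩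
    -- The displacement parameter has modulus `artanh ‖ζ‖` and the phase of `ζ`.
    obtain ⟨k, x, hU, hx⟩ := hb.exists_displacement_orbit htop he (Real.artanh ‖ζ‖)
    have hpolar : Complex.exp (Complex.I * (Complex.arg ζ : ℂ)) *
        (Real.tanh (Real.artanh ‖ζ‖) : ℝ) = ζ := by
      rw [Real.tanh_artanh hζ', mul_comm, mul_comm Complex.I]
      exact Complex.norm_mul_exp_arg_mul_I ζ
    rw [hpolar] at hx
    have hstate : R.coherentState (c • (b 0 : H)) ζ = c • k • x := by
      rw [← hU, SU11.UnitaryRep.coherentState, map_smul]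
      congr 3
      rw [Real.artanh_eq_half_log (Set.Ioo_subset_Icc_self hζ')]
      push_cast
      ring
    have hax : a x = ζ • x := by
      refine SU11.UnitaryRep.eq_of_inner_eq htop fun n => ?_
      have hs := SU11.UnitaryRep.ladderCoeff_ne_zero hl n
      have h := congrArg (fun y : ℝ => (y : ℂ)) (SU11.UnitaryRep.coherentCoeff_succ l n)
      push_cast at h
      rw [ha, hx, inner_smul_right, hx, div_mul_eq_mul_div, div_eq_iff hs]
      linear_combination ζ ^ (n + 1) * h
    rw [hstate, map_smul, map_smul, hax, smul_comm k ζ, smul_comm c ζ]
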